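/- Let $c,\nu\in\mathbb C$. Let $\mathsf{Vir}$ be the Virasoro algebra, with basis $L_n$ ($n\in\mathbb Z$) and a central element $C$ acting by the scalar $c$ in all modules below, so that $$[L_m,L_n]=(m-n)L_{m+n}+\tfrac{c}{12}\,m(m^2-1)\,\delta_{m+n,0}.$$ Let $\mathcal V^{[2]}_\nu$ be the rank $2$ Whittaker module, i.e. the $\mathsf{Vir}$-module induced from the one-dimensional representation $\mathbb C|J\rangle$ of the subalgebra spanned by $C$ and the $L_n$, $n\ge2$, given by $$L_{n}|J\rangle=0\ (n>4),\qquad L_4|J\rangle=\tfrac14|J\rangle,\qquad L_3|J\rangle=0,\qquad L_2|J\rangle=-\nu|J\rangle,\qquad C|J\rangle=c|J\rangle .$$ For a partition $\lambda=(\lambda_1\ge\dots\ge\lambda_\ell\ge1)$ put $\mathbb L_{-\lambda}=L_{-\lambda_1}\cdots L_{-\lambda_\ell}$ and $|\lambda|=\lambda_1+\dots+\lambda_\ell$. The vectors $\mathbb L_{-\lambda}L_0^{m_0}L_1^{m_1}|J\rangle$, with $\lambda$ a partition (possibly empty) and $m_0,m_1\in\mathbb Z_{\ge0}$, form a basis of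 $\mathcal V^{[2]}_\nu$ (the PBW basis). **Theorem.** There exists a unique formal power series in $\varepsilon$ with coefficients in $\mathcal V^{[2]}_\nu$, $$|\Psi\rangle=|J\rangle+\sum_{k=1}^\infty\varepsilon^k\,\mathbb G_k|J\rangle,\qquad \mathbb G_k=\sum_{\lambda,m_0,m_1}G^{[k]}_{\lambda;m_0,m_1}\,\mathbb L_{-\lambda}L_0^{m_0}L_1^{m_1}$$ (finite sums, with coefficients $G^{[k]}_{\lambda;m_0,m_1}\in\mathbb C$ independent of $\varepsilon$), such that $$L_n|\Psi\rangle=0\ (n\ge6),\qquad L_5|\Psi\rangle=\varepsilon|\Psi\rangle,\qquad L_4|\Psi\rangle=\tfrac14|\Psi\rangle,\qquad L_3|\Psi\rangle=0$$ (the $L_n$ acting coefficientwise) and such that $|\Psi\rangle$ is in the orthogonal gauge, i.e. $G^{[k]}_{\emptyset;0,0}=0$ for all $k\ge1$. Moreover, for every $k\ge1$ the coefficient $G^{[k]}_{\lambda;m_0,m_1}$ vanishes unless $$1\le m_1+2m_0+|\lambda|\le k\qquad\text{and}\qquad m_1+2m_0+|\lambda|\equiv k \pmod 2 .$$ -/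

import Mathlib

noncomputable section

/-- The underlying vector space of the Virasoro algebra `Vir`: the elements are
`∑ₙ x.1 n • Lₙ + x.2 • C`, with `C` the central element. -/
def Virasoro : Type := (ℤ →₀ ℂ) × ℂ

namespace Virasoro

instance : AddCommGroup Virasoro := inferInstanceAs (AddCommGroup ((ℤ →₀ ℂ) × ℂ))

instance : Module ℂ Virasoro := inferInstanceAs (Module ℂ ((ℤ →₀ ℂ) × ℂ))

/-- The generator `Lₙ`. -/
def L (n : ℤ) : Virasoro := (Finsupp.single n 1, 0)

/-- The central element `C`. -/
def C : Virasoro := (0, 1)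

/-- The value of the bracket on two generators,
`[Lₘ, Lₙ] = (m - n) Lₘ₊ₙ + (m (m² - 1) / 12) δ_{m+n,0} C`. -/
def bracketGen (m n : ℤ) : Virasoro :=
  (((m : ℂ) - n) • L (m + n)) + (if m + n = 0 then (m : ℂ) * ((m : ℂ) ^ 2 - 1) / 12 else 0) • C

/-- The bilinear extension of `bracketGen` to the span of the generators `Lₙ`. -/
def bracketAux : (ℤ →₀ ℂ) →ₗ[ℂ] (ℤ →₀ ℂ) →ₗ[ℂ] Virasoro :=
  Finsupp.linearCombination ℂ fun m => Finsupp.linearCombination ℂ fun n => bracketGen m n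

/-- The element `C` is central, so the bracket only sees the components along the `Lₙ`. -/
instance : Bracket Virasoro Virasoro := ⟨fun x y => bracketAux x.1 y.1⟩

theorem bracket_def (x y : Virasoro) : ⁅x, y⁆ = bracketAux x.1 y.1 := rfl

theorem fst_zero : (0 : Virasoro).1 = 0 := rfl

theorem fst_add (x y : Virasoro) : (x + y).1 = x.1 + y.1 := rfl

theorem fst_smul (t : ℂ) (x : Virasoro) : (t • x).1 = t • x.1 := rfl

theorem fst_L (n : ℤ) : (L n).1 = Finsupp.single n 1 := rfl

theorem fst_C : C.1 = 0 := rfl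

theorem bracketAux_single (m n : ℤ) (s t : ℂ) :
    bracketAux (Finsupp.single m s) (Finsupp.single n t) = (s * t) • bracketGen m n := by
  simp [bracketAux, Finsupp.linearCombination_single, mul_smul]

theorem bracketGen_swap (m n : ℤ) : bracketGen m n = -bracketGen n m := by
  unfold bracketGen
  rw [add_comm n m]
  by_cases h : m + n = 0
  · have hm : (m : ℂ) = -n := by
      have : m = -n := by omega
      rw [this]; push_cast; ring
    simp only [h, if_true, hm]
    module
  · simp only [h, if_false]
    module

theorem bracketAux_swap (f g : ℤ →₀ ℂ) : bracketAux f g = -bracketAux g f := by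
  induction f using Finsupp.induction_linear with
  | zero => simp
  | add f₁ f₂ h₁ h₂ => simp only [map_add, LinearMap.add_apply, h₁, h₂]; abel
  | single m s =>
    induction g using Finsupp.induction_linear with
    | zero => simp
    | add g₁ g₂ h₁ h₂ => simp only [map_add, LinearMap.add_apply, h₁, h₂]; abel
    | single n t =>
      rw [bracketAux_single, bracketAux_single, bracketGen_swap m n, mul_comm s t, smul_neg]

theorem fst_bracketGen (m n : ℤ) :
    (bracketGen m n).1 = Finsupp.single (m + n) ((m : ℂ) - n) := by
  rw [bracketGen, fst_add, fst_smul, fst_smul, fst_L, fst_C, smul_zero, add_zero,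
    Finsupp.smul_single, smul_eq_mul, mul_one]

theorem jacobi_single (l m n : ℤ) (r s t : ℂ) :
    bracketAux (Finsupp.single l r)
        (bracketAux (Finsupp.single m s) (Finsupp.single n t)).1 =
      bracketAux (bracketAux (Finsupp.single l r) (Finsupp.single m s)).1 (Finsupp.single n t) +
      bracketAux (Finsupp.single m s)
        (bracketAux (Finsupp.single l r) (Finsupp.single n t)).1 := by
  simp only [bracketAux_single, fst_smul, fst_bracketGen, Finsupp.smul_single, smul_eq_mul]
  unfold bracketGen
  rw [show l + (m + n) = l + m + n by ring, show m + (l + n) = l + m + n by ring]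
  by_cases h : l + m + n = 0
  · have hn : (n : ℂ) = -l - m := by
      have : n = -l - m := by omega
      rw [this]; push_cast; ring
    simp only [h, if_true]
    push_cast
    rw [hn]
    module
  · simp only [h, if_false]
    push_cast
    module

theorem jacobi (f g h : ℤ →₀ ℂ) :
    bracketAux f (bracketAux g h).1 =
      bracketAux (bracketAux f g).1 h + bracketAux g (bracketAux f h).1 := by
  induction f using Finsupp.induction_linear with
  | zero => simp only [map_zero, LinearMap.zero_apply, fst_zero, add_zero]
  | add f₁ f₂ h₁ h₂ => simp only [map_add, LinearMap.add_apply, fst_add, h₁, h₂]; abel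
  | single l r =>
    induction g using Finsupp.induction_linear with
    | zero => simp only [map_zero, LinearMap.zero_apply, fst_zero, add_zero]
    | add g₁ g₂ h₁ h₂ => simp only [map_add, LinearMap.add_apply, fst_add, h₁, h₂]; abel
    | single m s =>
      induction h using Finsupp.induction_linear with
      | zero => simp only [map_zero, fst_zero, add_zero]
      | add k₁ k₂ h₁ h₂ => simp only [map_add, fst_add, h₁, h₂]; abel
      | single n t => exact jacobi_single l m n r s t

instance : LieRing Virasoro where
  add_lie x y z := by simp [bracket_def, fst_add]
  lie_add x y z := by simp [bracket_def, fst_add]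
  lie_self x := by
    have h := bracketAux_swap x.1 x.1
    rw [bracket_def]
    have h2 : (2 : ℂ) • bracketAux x.1 x.1 = 0 := by
      rw [two_smul]
      exact eq_neg_iff_add_eq_zero.mp h
    exact (smul_eq_zero.mp h2).resolve_left two_ne_zero
  leibniz_lie x y z := jacobi x.1 y.1 z.1

instance : LieAlgebra ℂ Virasoro where
  lie_smul t x y := by simp [bracket_def, fst_smul]

/-- The commutation relations of the generators. -/
theorem lie_L_L (m n : ℤ) :
    ⁅L m, L n⁆ = ((m : ℂ) - n) • L (m + n) +
      (if m + n = 0 then (m : ℂ) * ((m : ℂ) ^ 2 - 1) / 12 else 0) • C := by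
  rw [bracket_def, fst_L, fst_L, bracketAux_single, mul_one, one_smul, bracketGen]

/-- The element `C` is central. -/
theorem lie_C (x : Virasoro) : ⁅x, C⁆ = 0 := by
  rw [bracket_def, fst_C, map_zero]

/-- The universal enveloping algebra `U(Vir)`. -/
abbrev U : Type := UniversalEnvelopingAlgebra ℂ Virasoro

/-- The generator `Lₙ` as an element of `U(Vir)`. -/
def uL (n : ℤ) : U := UniversalEnvelopingAlgebra.ι ℂ (L n)

/-- The central element as an element of `U(Vir)`. -/
def uC : U := UniversalEnvelopingAlgebra.ι ℂ C

/-- The eigenvalues of `Lₙ`, `n ≥ 2`, on the rank 2 Whittaker state `|J⟩`: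
`L₂ ↦ -ν`, `L₃ ↦ 0`, `L₄ ↦ 1/4` and `Lₙ ↦ 0` for `n > 4`. -/
def whittakerChar (ν : ℂ) (n : ℤ) : ℂ :=
  if n = 2 then -ν else if n = 4 then 1 / 4 else 0

/-- The left ideal of `U(Vir)` generated by `C - c` and by `Lₙ - whittakerChar ν n`, `n ≥ 2`. -/
def whittakerIdeal (c ν : ℂ) : Submodule U U :=
  Submodule.span U
    (insert (uC - algebraMap ℂ U c)
      {u | ∃ n : ℤ, 2 ≤ n ∧ u = uL n - algebraMap ℂ U (whittakerChar ν n)})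

/-- The rank 2 Whittaker module at central charge `c`: the `Vir`-module induced from the
one-dimensional representation `ℂ|J⟩` of the subalgebra spanned by `C` and the `Lₙ` with
`n ≥ 2`, that is, the quotient of `U(Vir)` by the left ideal which annihilates `|J⟩`. -/
abbrev WhittakerModule (c ν : ℂ) : Type := U ⧸ whittakerIdeal c ν

/-- The rank 2 Whittaker state `|J⟩`. -/
def J (c ν : ℂ) : WhittakerModule c ν := Submodule.Quotient.mk 1

/-- The labels `(λ; m₀, m₁)` of the PBW monomials. -/
structure PBWIndex where
  /-- The partition `λ`, as a Young diagram. -/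
  shape : YoungDiagram
  /-- The exponent of `L₀`. -/
  m₀ : ℕ
  /-- The exponent of `L₁`. -/
  m₁ : ℕ

namespace PBWIndex

/-- The label `(∅; 0, 0)` of the monomial `1`. -/
def vac : PBWIndex := ⟨⊥, 0, 0⟩

/-- The degree `m₁ + 2 m₀ + |λ|`. -/
def deg (i : PBWIndex) : ℕ := i.m₁ + 2 * i.m₀ + i.shape.card

/-- The monomial `L_{-λ₁} ⋯ L_{-λ_ℓ} L₀^{m₀} L₁^{m₁}`, where `λ₁ ≥ ⋯ ≥ λ_ℓ ≥ 1` are the parts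
of `λ`. -/
def monomial (i : PBWIndex) : U :=
  (i.shape.rowLens.map fun p => uL (-(p : ℤ))).prod * uL 0 ^ i.m₀ * uL 1 ^ i.m₁

end PBWIndex

/-- Formal power series `∑ₖ εᵏ Ψ k` with coefficients in the Whittaker module. -/
abbrev WhittakerSeries (c ν : ℂ) : Type := ℕ → WhittakerModule c ν

/-- Multiplication of a formal power series by `ε`. -/
def epsMul {c ν : ℂ} (Ψ : WhittakerSeries c ν) : WhittakerSeries c ν
  | 0 => 0
  | k + 1 => Ψ k

/-- The defining relations of a Whittaker state of rank `5/2`, for a formal power series in `ε`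
on which `U(Vir)` and `ℂ` act coefficientwise. -/
structure IsWhittaker52 {c ν : ℂ} (Ψ : WhittakerSeries c ν) : Prop where
  L_ge_six : ∀ n : ℤ, 6 ≤ n → uL n • Ψ = 0
  L_five : uL 5 • Ψ = epsMul Ψ
  L_four : uL 4 • Ψ = (1 / 4 : ℂ) • Ψ
  L_three : uL 3 • Ψ = 0

/-- `Ψ` is a rank `5/2` Whittaker state of the form `|J⟩ + ∑_{k ≥ 1} εᵏ Gₖ|J⟩` in the orthogonal
gauge: in the basis `b` (that of the PBW monomials), no `Gₖ|J⟩` with `k ≥ 1` has a component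
along `|J⟩`. -/
structure IsOrthogonalWhittaker52 {c ν : ℂ}
    (b : Module.Basis PBWIndex ℂ (WhittakerModule c ν)) (Ψ : WhittakerSeries c ν) : Prop where
  whittaker : IsWhittaker52 Ψ
  coeff_zero : Ψ 0 = J c ν
  gauge : ∀ k : ℕ, 1 ≤ k → b.repr (Ψ k) PBWIndex.vac = 0

end Virasoro

end

/-!
The state `Ψ` is constructed by duality. Let `zₙ = Lₙ - χ(n)`, where `χ` is the character of the
vector `|J⟩`, and let `⟨·⟩` be the component along `|J⟩` in the PBW basis. On the algebra generated
by the `zₙ` with `n ≥ 3` the required relations say that every `u` acts on `Ψ` through the character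
`z₅ ↦ ε`, `zₙ ↦ 0` (`n ≠ 5`), so together with the gauge condition they determine all the numbers
`⟨u Ψₖ⟩`: on words in the `zₙ` they are `1` for `z₅ᵏ` and `0` otherwise (`charCoeff`). It remains to
see that a vector `v` is determined by the numbers `⟨u v⟩`, and that these values are attained.

*Determination* (`eq_zero_of_vacCoord`) and the linear independence of the PBW monomials both come
from a free field realization. On the Fock space of one boson with a background charge, the
Sugawara operators shifted by `a₂ ↦ a₂ + s` have the form `s aₙ₋₂` plus terms of lower weight, and
they represent the Virasoro algebra with any prescribed `c` and `ν`, the vacuum being a Whittaker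
vector. Hence the image of a PBW monomial has as leading term the monomial in which each factor `Lₙ`
is replaced by `s` times the creation operator `aₙ₋₂` (`Fock.linearIndependent_irrVir`), and the `zₙ` with
`n ≥ 3` act as the derivatives `aₙ₋₂` up to lower weight, so that they lower the weight and have
only the constants as common kernel (`Fock.eq_C_of_irrVir`).

*Attainment* (`exists_whittakerTerm`) is a dimension count. For the degree `|λ| + 2 m₀ + m₁`,
extended to all `Lₙ` by `letterDeg`, commutators do not raise the degree and preserve its parity, so
words in the `zₙ` respect the filtration `degLE` (`shiftWord_J_mem_degLE`). The reflection
`n ↦ 4 - n` matches the PBW monomials of degree `d` with sorted words in the `zₙ`, `n ≥ 3`, of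
degree `-d`. The pairing of monomials with these words on the part of degree at most `k` and parity
`k` is therefore given by a finite square matrix, which is injective by the determination property,
hence invertible. Agreement on sorted words extends to all words because the prescribed functional
comes from a character (`vacCoord_shiftWord_eq`). The bound and the parity in the theorem hold
because `Ψₖ` is found in this part.
-/

noncomputable section

namespace Virasoro

section FreeField

open MvPolynomial

/-! ### The free boson -/

/-- The Fock space: polynomials in the creation operators, the variable `X k` being `a₋₍ₖ₊₁₎`. -/
abbrev Fock : Type := MvPolynomial ℕ ℂ

namespace Fock

/-- The modes of a free boson of momentum `μ`, with `[aₘ, aₙ] = m δ_{m+n,0}`. -/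
def a (μ : ℂ) : ℤ → Module.End ℂ Fock
  | .ofNat 0 => μ • 1
  | .ofNat (k + 1) => ((k : ℂ) + 1) • (pderiv k).toLinearMap
  | .negSucc k => LinearMap.mulLeft ℂ (X k)

theorem a_zero (μ : ℂ) : a μ 0 = μ • 1 := rfl

theorem a_pos (μ : ℂ) (k : ℕ) (p : Fock) : a μ (k + 1) p = ((k : ℂ) + 1) • pderiv k p := rfl

theorem a_neg (μ : ℂ) (k : ℕ) (p : Fock) : a μ (-(k + 1)) p = X k * p := by
  rw [show -((k : ℤ) + 1) = Int.negSucc k by omega]; rfl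

/-- Every integer is zero, positive or negative, in the form suited to the definition of `a`. -/
theorem int_cases (n : ℤ) : n = 0 ∨ (∃ k : ℕ, n = k + 1) ∨ ∃ k : ℕ, n = -(k + 1) := by
  rcases lt_trichotomy n 0 with h | h | h
  · exact .inr (.inr ⟨(-n - 1).toNat, by omega⟩)
  · exact .inl h
  · exact .inr (.inl ⟨(n - 1).toNat, by omega⟩)

theorem a_comm (μ : ℂ) (m n : ℤ) (p : Fock) :
    a μ m (a μ n p) = a μ n (a μ m p) + (if m + n = 0 then (m : ℂ) else 0) • p := by
  rcases int_cases m with rfl | ⟨j, rfl⟩ | ⟨j, rfl⟩ <;>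
  rcases int_cases n with rfl | ⟨k, rfl⟩ | ⟨k, rfl⟩
  · simp
  · simp [a_zero]
  · simp [a_zero]
  · simp [a_zero]
    intro h; omega
  · have h : ¬ ((j : ℤ) + 1 + (k + 1) = 0) := by omega
    have hc : pderiv j (pderiv k p) = pderiv k (pderiv j p) := by
      have h0 : ⁅(pderiv j : Derivation ℂ Fock Fock), (pderiv k : Derivation ℂ Fock Fock)⁆ = 0 := by
        refine derivation_ext (R := ℂ) (σ := ℕ) (A := Fock) fun i => ?_
        simp [Derivation.commutator_apply, pderiv_X, Pi.single_apply, apply_ite]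
      have := congrArg (fun d : Derivation ℂ Fock Fock => d p) h0
      simpa [Derivation.commutator_apply, sub_eq_zero] using this
    simp only [a_pos, h, if_false, zero_smul, add_zero, map_smul, hc]
    rw [smul_comm]
  · simp only [a_pos, a_neg, pderiv_mul, pderiv_X, Pi.single_apply]
    by_cases h : j = k
    · subst h; simp [smul_add]; ring
    · have h' : ¬ ((j : ℤ) + 1 + -(k + 1) = 0) := by omega
      have h'' : ¬ k = j := fun e => h e.symm
      rw [if_neg h']
      simp [h'', smul_eq_C_mul]; ring
  · simp [a_zero]
    intro h; omega
  · simp only [a_pos, a_neg, pderiv_mul, pderiv_X, Pi.single_apply]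
    by_cases h : j = k
    · subst h; simp [smul_add, smul_eq_C_mul]; ring
    · have h' : ¬ (-((j : ℤ) + 1) + (k + 1) = 0) := by omega
      rw [if_neg h']
      simp [h, smul_eq_C_mul]; ring
  · have h : ¬ (-((j : ℤ) + 1) + -((k : ℤ) + 1) = 0) := by omega
    simp only [a_neg, h, if_false, zero_smul, add_zero]
    ring

/-- An operator commuting with all modes is the multiplication by the constant term of its value
at the vacuum `1`. -/
theorem eq_smul_of_commute (μ : ℂ) (D : Module.End ℂ Fock)
    (h : ∀ k p, D (a μ k p) = a μ k (D p)) (p : Fock) : D p = constantCoeff (D 1) • p := by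
  have hX (k : ℕ) (p : Fock) : D (X k * p) = X k * D p := by
    rw [← a_neg μ, ← a_neg μ, h]
  -- All derivatives of `D 1` vanish, since they do for `1`.
  have h1 : D 1 = MvPolynomial.C (constantCoeff (D 1)) := by
    ext m
    rw [coeff_C]
    split_ifs with hm
    · subst hm; simp [constantCoeff_eq]
    · obtain ⟨i, hi⟩ : ∃ i, m i ≠ 0 := by
        by_contra! hc; exact hm (Finsupp.ext fun i => by simp [hc i])
      have h2 : pderiv i (D 1) = 0 := by
        have := h (i + 1) 1
        rw [a_pos, a_pos, pderiv_one, smul_zero, map_zero] at this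
        exact (smul_eq_zero.mp this.symm).resolve_left (by exact_mod_cast i.succ_ne_zero)
      have h3 := coeff_pderiv (i := i) (D 1) (m - Finsupp.single i 1)
      rw [h2, coeff_zero, tsub_add_cancel_of_le (by simpa [Nat.one_le_iff_ne_zero] using hi)] at h3
      exact (mul_eq_zero.mp h3.symm).resolve_right (Nat.cast_add_one_ne_zero _)
  induction p using MvPolynomial.induction_on with
  | C r =>
    rw [show (MvPolynomial.C r : Fock) = r • 1 by simp [smul_eq_C_mul], map_smul, h1]
    simp [smul_eq_C_mul, mul_comm]
  | add p q hp hq => rw [map_add, hp, hq, smul_add]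
  | mul_X p i hp => rw [mul_comm, hX, hp, mul_smul_comm]

/-- The part of `Lₙ` with one creation and one annihilation operator, `∑_{j ≥ 1, j > n}
aₙ₋ⱼ aⱼ`: since `aⱼ = j ∂/∂a₋ⱼ`, this is the derivation `a₋ⱼ ↦ j aₙ₋ⱼ` (`j > n`). -/
def derivPart (n : ℤ) : Derivation ℂ Fock Fock :=
  mkDerivation ℂ fun k => if n < k + 1 then ((k : ℂ) + 1) • X ((k : ℤ) - n).toNat else 0

/-- The part of `Lₙ` with two creation or two annihilation operators, `½ ∑ aᵢ aₙ₋ᵢ` over the `i`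
strictly between `0` and `n`. -/
def quadPart (μ : ℂ) (n : ℤ) : Module.End ℂ Fock :=
  (1 / 2 : ℂ) • ∑ i ∈ Finset.Ioo 0 n ∪ Finset.Ioo n 0, a μ i * a μ (n - i)

/-- The part of `Lₙ` involving the momentum `μ` and the background charge `lam`. -/
def linPart (μ lam : ℂ) (n : ℤ) : Module.End ℂ Fock :=
  if n = 0 then ((μ ^ 2 - lam ^ 2) / 2) • 1 else (μ + lam * n) • a μ n

/-- The Virasoro operators of a free boson of momentum `μ` and background charge `lam`. -/
def vir (μ lam : ℂ) (n : ℤ) : Module.End ℂ Fock :=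
  (derivPart n).toLinearMap + quadPart μ n + linPart μ lam n

theorem derivPart_X (n : ℤ) (k : ℕ) : derivPart n (X k) =
    if n < k + 1 then ((k : ℂ) + 1) • X ((k : ℤ) - n).toNat else 0 := by
  simp [derivPart, mkDerivation_X]

theorem derivPart_comm (μ : ℂ) (n m : ℤ) (p : Fock) : derivPart n (a μ m p) =
    a μ m (derivPart n p) - (if 0 < m * (m + n) then (m : ℂ) else 0) • a μ (m + n) p := by
  rcases int_cases m with rfl | ⟨k, rfl⟩ | ⟨k, rfl⟩
  · simp [a_zero]
  · rw [a_pos, a_pos, Derivation.map_smul]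
    have hpos : (0 < ((k : ℤ) + 1) * (k + 1 + n)) ↔ 0 < (k : ℤ) + 1 + n :=
      mul_pos_iff_of_pos_left (by omega)
    simp only [hpos]
    have key : ⁅derivPart n, (pderiv k : Derivation ℂ Fock Fock)⁆ = if h : 0 < (k : ℤ) + 1 + n then
        (-((k : ℂ) + 1 + n)) • pderiv ((k : ℤ) + n).toNat else 0 := by
      refine derivation_ext (R := ℂ) (σ := ℕ) (A := Fock) fun i => ?_
      rw [Derivation.commutator_apply, pderiv_X, derivPart_X]
      have e1 : derivPart n (Pi.single (M := fun _ => Fock) k 1 i) = 0 := by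
        by_cases h : i = k
        · subst h; simp
        · simp [h]
      rw [e1]
      by_cases h : 0 < (k : ℤ) + 1 + n
      · by_cases hi : (i : ℤ) = k + n
        · have h1 : n < (i : ℤ) + 1 := by omega
          have h2 : ((i : ℤ) - n).toNat = k := by omega
          have h3 : ((k : ℤ) + n).toNat = i := by omega
          have h4 : (i : ℂ) = k + n := by exact_mod_cast hi
          simp only [h, h1, h2, h3, dite_true, if_true, Derivation.map_smul, pderiv_X_self,
            Derivation.smul_apply, zero_sub, h4]
          rw [← neg_smul]; congr 1; ring
        · have h3 : ((k : ℤ) + n).toNat ≠ i := by omega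
          simp only [h, dite_true, Derivation.smul_apply, pderiv_X_of_ne h3.symm, smul_zero]
          split_ifs with h1
          · have h2 : ((i : ℤ) - n).toNat ≠ k := by omega
            simp [pderiv_X_of_ne h2]
          · simp
      · simp only [h, dite_false, Derivation.zero_apply]
        split_ifs with h1
        · have h2 : ((i : ℤ) - n).toNat ≠ k := by omega
          simp [pderiv_X_of_ne h2]
        · simp
    have := congrArg (fun d : Derivation ℂ Fock Fock => d p) key
    simp only [Derivation.commutator_apply, sub_eq_iff_eq_add] at this
    rw [this]
    split_ifs with h
    · rw [show (k : ℤ) + 1 + n = (((k : ℤ) + n).toNat : ℤ) + 1 by omega, a_pos]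
      have h4 : ((((k : ℤ) + n).toNat : ℤ) : ℂ) = k + n := by
        rw [Int.toNat_of_nonneg (by omega)]; push_cast; ring
      rw [Int.cast_natCast] at h4
      rw [h4]
      simp only [Derivation.smul_apply]
      push_cast
      module
    · simp
  · rw [a_neg, a_neg, Derivation.leibniz, derivPart_X]
    have hpos : (0 < (-((k : ℤ) + 1)) * (-(k + 1) + n)) ↔ n < (k : ℤ) + 1 := by
      rw [show (-((k : ℤ) + 1)) * (-(k + 1) + n) = (k + 1) * (k + 1 - n) by ring,
        mul_pos_iff_of_pos_left (by omega), sub_pos]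
    simp only [hpos]
    split_ifs with h
    · rw [show -((k : ℤ) + 1) + n = -((((k : ℤ) - n).toNat : ℤ) + 1) by omega, a_neg]
      simp [smul_eq_C_mul]; ring
    · simp

theorem quadPart_comm (μ : ℂ) (n m : ℤ) (p : Fock) : quadPart μ n (a μ m p) =
    a μ m (quadPart μ n p) -
      (if m * (m + n) < 0 then (m : ℂ) else 0) • a μ (m + n) p := by
  have hmem : (m + n ∈ Finset.Ioo 0 n ∪ Finset.Ioo n 0) ↔ m * (m + n) < 0 := by
    simp only [Finset.mem_union, Finset.mem_Ioo, mul_neg_iff]; omega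
  have hmem' : (-m ∈ Finset.Ioo 0 n ∪ Finset.Ioo n 0) ↔ m * (m + n) < 0 := by
    simp only [Finset.mem_union, Finset.mem_Ioo, mul_neg_iff]; omega
  have hterm (i : ℤ) : a μ i (a μ (n - i) (a μ m p)) = a μ m (a μ i (a μ (n - i) p)) +
      ((if m + n = i then (-m : ℂ) • a μ (m + n) p else 0) +
        if -m = i then (-m : ℂ) • a μ (m + n) p else 0) := by
    rw [a_comm μ (n - i) m, map_add, map_smul, a_comm μ i m]
    have e1 : (n - i + m = 0) ↔ m + n = i := by omega
    have e2 : (i + m = 0) ↔ -m = i := by omega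
    simp only [e1, e2]
    have h1 : (if m + n = i then ((n - i : ℤ) : ℂ) else 0) • a μ i p =
        if m + n = i then (-m : ℂ) • a μ (m + n) p else 0 := by
      split_ifs with h
      · subst h; congr 1; push_cast; ring
      · simp
    have h2 : (if -m = i then (i : ℂ) else 0) • a μ (n - i) p =
        if -m = i then (-m : ℂ) • a μ (m + n) p else 0 := by
      split_ifs with h
      · subst h
        rw [show n - -m = m + n by ring]; push_cast; rfl
      · simp
    rw [h1, h2]; abel
  simp only [quadPart, LinearMap.smul_apply, LinearMap.sum_apply, Module.End.mul_apply, hterm,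
    Finset.sum_add_distrib, Finset.sum_ite_eq, hmem, hmem', map_smul, map_sum]
  split_ifs <;> module

theorem linPart_comm (μ lam : ℂ) (n m : ℤ) (p : Fock) : linPart μ lam n (a μ m p) =
    a μ m (linPart μ lam n p) + (if m + n = 0 then (-m * μ + lam * n ^ 2 : ℂ) else 0) • p := by
  unfold linPart
  by_cases h : n = 0
  · subst h
    by_cases hm : m = 0
    · subst hm; simp
    · simp [hm]
  · simp only [h, if_false, LinearMap.smul_apply, a_comm μ n m, map_smul, smul_add]
    rw [add_comm n m]
    split_ifs with h1
    · have : (n : ℂ) = -m := by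
        have : n = -m := by omega
        rw [this]; push_cast; ring
      rw [this]; module
    · simp

/-- The field `a` is primary up to the anomaly of the background charge. -/
theorem vir_comm (μ lam : ℂ) (n m : ℤ) (p : Fock) : vir μ lam n (a μ m p) =
    a μ m (vir μ lam n p) - (m : ℂ) • a μ (m + n) p +
      (if m + n = 0 then lam * (n : ℂ) ^ 2 else 0) • p := by
  simp only [vir, LinearMap.add_apply, Derivation.coeFn_coe,
    derivPart_comm μ n, quadPart_comm, linPart_comm, map_add]
  rcases lt_trichotomy (m * (m + n)) 0 with h | h | h
  · have h1 : ¬ 0 < m * (m + n) := by omega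
    have h2 : ¬ m + n = 0 := by rintro e; simp [e] at h
    simp only [h, h1, h2, if_true, if_false]; module
  · simp only [h, lt_irrefl, if_false]
    split_ifs with h2
    · rw [h2, a_zero, LinearMap.smul_apply, Module.End.one_apply]; module
    · have : m = 0 := (mul_eq_zero.mp h).resolve_right h2
      subst this; simp
  · have h1 : ¬ m * (m + n) < 0 := by omega
    have h2 : ¬ m + n = 0 := by rintro e; simp [e] at h
    simp only [h, h1, h2, if_true, if_false]; module

/-! ### Vacuum expectation values and the Virasoro relations -/

theorem constantCoeff_a_neg (μ : ℂ) {n : ℤ} (hn : n < 0) (p : Fock) :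
    constantCoeff (a μ n p) = 0 := by
  rcases int_cases n with rfl | ⟨k, rfl⟩ | ⟨k, rfl⟩
  · omega
  · omega
  · rw [a_neg]; simp

theorem a_one_of_pos (μ : ℂ) {n : ℤ} (hn : 0 < n) : a μ n 1 = 0 := by
  rcases int_cases n with rfl | ⟨k, rfl⟩ | ⟨k, rfl⟩
  · omega
  · simp [a_pos]
  · omega

theorem constantCoeff_a_one (μ : ℂ) (n : ℤ) :
    constantCoeff (a μ n 1) = if n = 0 then μ else 0 := by
  rcases lt_trichotomy n 0 with h | rfl | h
  · rw [constantCoeff_a_neg μ h, if_neg h.ne]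
  · simp [a_zero]
  · rw [a_one_of_pos μ h, if_neg h.ne', map_zero]

theorem constantCoeff_a_a_one (μ : ℂ) (m : ℤ) {n : ℤ} (hn : n < 0) :
    constantCoeff (a μ m (a μ n 1)) = if m + n = 0 then (m : ℂ) else 0 := by
  rw [a_comm, map_add, constantCoeff_a_neg μ hn, constantCoeff_smul]
  simp

theorem constantCoeff_derivPart (n : ℤ) (p : Fock) : constantCoeff (derivPart n p) = 0 := by
  induction p using MvPolynomial.induction_on with
  | C r => simp
  | add p q hp hq => simp [hp, hq]
  | mul_X p i hp =>
    rw [Derivation.leibniz, derivPart_X]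
    split_ifs <;> simp [hp]

theorem constantCoeff_quadPart_of_nonpos (μ : ℂ) {n : ℤ} (hn : n ≤ 0) (p : Fock) :
    constantCoeff (quadPart μ n p) = 0 := by
  have h (i) (hi : i ∈ Finset.Ioo 0 n ∪ Finset.Ioo n 0) :
      constantCoeff ((a μ i * a μ (n - i)) p) = 0 := by
    simp only [Finset.mem_union, Finset.mem_Ioo] at hi
    exact constantCoeff_a_neg μ (by omega) _
  simp only [quadPart, LinearMap.smul_apply, LinearMap.sum_apply, constantCoeff_smul, map_sum]
  rw [Finset.sum_eq_zero h, smul_zero]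

theorem quadPart_one_of_nonneg (μ : ℂ) {n : ℤ} (hn : 0 ≤ n) : quadPart μ n 1 = 0 := by
  have h (i) (hi : i ∈ Finset.Ioo 0 n ∪ Finset.Ioo n 0) : (a μ i * a μ (n - i)) (1 : Fock) = 0 := by
    simp only [Finset.mem_union, Finset.mem_Ioo] at hi
    rw [Module.End.mul_apply, a_one_of_pos μ (by omega), map_zero]
  simp only [quadPart, LinearMap.smul_apply, LinearMap.sum_apply]
  rw [Finset.sum_eq_zero h, smul_zero]

theorem constantCoeff_vir_of_neg (μ lam : ℂ) {n : ℤ} (hn : n < 0) (p : Fock) :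
    constantCoeff (vir μ lam n p) = 0 := by
  simp [vir, constantCoeff_derivPart, constantCoeff_quadPart_of_nonpos μ hn.le, linPart, hn.ne,
    constantCoeff_a_neg μ hn]

theorem vir_one_of_pos (μ lam : ℂ) {n : ℤ} (hn : 0 < n) : vir μ lam n 1 = 0 := by
  simp [vir, quadPart_one_of_nonneg μ hn.le, linPart, hn.ne', a_one_of_pos μ hn]

theorem vir_zero_one (μ lam : ℂ) : vir μ lam 0 1 = ((μ ^ 2 - lam ^ 2) / 2) • (1 : Fock) := by
  simp [vir, quadPart_one_of_nonneg μ le_rfl, linPart]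

theorem constantCoeff_vir_zero (μ lam : ℂ) (p : Fock) :
    constantCoeff (vir μ lam 0 p) = (μ ^ 2 - lam ^ 2) / 2 * constantCoeff p := by
  simp [vir, constantCoeff_derivPart, constantCoeff_quadPart_of_nonpos μ le_rfl, linPart]

theorem constantCoeff_vir_one (μ lam : ℂ) (n : ℤ) :
    constantCoeff (vir μ lam n 1) = if n = 0 then (μ ^ 2 - lam ^ 2) / 2 else 0 := by
  rcases lt_trichotomy n 0 with h | rfl | h
  · rw [constantCoeff_vir_of_neg μ lam h, if_neg h.ne]
  · simp [vir_zero_one]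
  · rw [vir_one_of_pos μ lam h, if_neg h.ne', map_zero]

theorem sum_Ioo_mul_sub (k : ℕ) :
    ∑ i ∈ Finset.Ioo (-((k : ℤ) + 1)) 0, (-(i : ℂ) * ((k : ℂ) + 1 + i)) =
      (((k : ℂ) + 1) ^ 3 - (k + 1)) / 6 := by
  have h1 : ∑ i ∈ Finset.Ioo (-((k : ℤ) + 1)) 0, (-(i : ℂ) * ((k : ℂ) + 1 + i)) =
      ∑ j ∈ Finset.range k, (((j : ℂ) + 1) * (k - j)) := by
    symm
    refine Finset.sum_nbij' (fun j : ℕ => -((j : ℤ) + 1)) (fun i : ℤ => (-i - 1).toNat)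
      ?_ ?_ ?_ ?_ ?_
    · intro j hj; simp only [Finset.mem_range] at hj; simp only [Finset.mem_Ioo]; omega
    · intro j hj; simp only [Finset.mem_Ioo] at hj; simp only [Finset.mem_range]; omega
    · intro j hj; omega
    · intro j hj; simp only [Finset.mem_Ioo] at hj; omega
    · intro j hj; push_cast; ring
  have h2 (N : ℕ) (x : ℂ) : ∑ j ∈ Finset.range N, (((j : ℂ) + 1) * (x - j)) =
      N * (N + 1) * (3 * x - 2 * N + 2) / 6 := by
    induction N with
    | zero => simp
    | succ N ih => rw [Finset.sum_range_succ, ih]; push_cast; ring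
  rw [h1, h2]; ring

theorem constantCoeff_vir_vir_one (μ lam : ℂ) {m n : ℤ} (hm : 0 < m) (hn : n < 0) :
    constantCoeff (vir μ lam m (vir μ lam n 1)) =
      if m + n = 0 then ((m : ℂ) ^ 3 - m) / 12 + m * (μ ^ 2 - lam ^ 2 * m ^ 2) else 0 := by
  have h1 (k : ℤ) (hk : k < 0) (p : Fock) : constantCoeff (vir μ lam m (a μ k p)) =
      -(k : ℂ) * constantCoeff (a μ (m + k) p) +
        (if m + k = 0 then lam * (m : ℂ) ^ 2 else 0) * constantCoeff p := by
    rw [vir_comm, map_add, map_sub, constantCoeff_a_neg μ hk, constantCoeff_smul,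
      constantCoeff_smul, add_comm k m]
    simp
  have h2 (i : ℤ) (hi : i ∈ Finset.Ioo n 0) :
      constantCoeff (vir μ lam m (a μ i (a μ (n - i) 1))) =
        if m + n = 0 then -(i : ℂ) * (m + i) else 0 := by
    rw [Finset.mem_Ioo] at hi
    rw [h1 i hi.2, constantCoeff_a_a_one μ _ (by omega), constantCoeff_a_neg μ (by omega),
      show m + i + (n - i) = m + n by ring]
    push_cast
    split_ifs <;> ring
  have h3 : vir μ lam n 1 = (1 / 2 : ℂ) • ∑ i ∈ Finset.Ioo n 0, a μ i (a μ (n - i) 1) +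
      (μ + lam * n) • a μ n 1 := by
    simp [vir, quadPart, linPart, hn.ne, Finset.Ioo_eq_empty (not_lt.mpr hn.le)]
  rw [h3, map_add, map_smul, map_smul, map_sum, map_add, constantCoeff_smul, constantCoeff_smul,
    map_sum, Finset.sum_congr rfl h2, h1 n hn, constantCoeff_a_one]
  split_ifs with h
  · obtain ⟨k, rfl⟩ : ∃ k : ℕ, m = k + 1 := ⟨(m - 1).toNat, by omega⟩
    obtain rfl : n = -((k : ℤ) + 1) := by omega
    push_cast
    rw [sum_Ioo_mul_sub]
    simp
    ring
  · simp

/-- The operators `vir μ lam n` satisfy the Virasoro relations with central charge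
`1 - 12 lam²`. -/
theorem vir_vir (μ lam : ℂ) (m n : ℤ) (p : Fock) :
    vir μ lam m (vir μ lam n p) = vir μ lam n (vir μ lam m p) +
      ((m : ℂ) - n) • vir μ lam (m + n) p +
      (if m + n = 0 then (m : ℂ) * ((m : ℂ) ^ 2 - 1) / 12 * (1 - 12 * lam ^ 2) else 0) • p := by
  set K : ℂ := if m + n = 0 then (m : ℂ) * ((m : ℂ) ^ 2 - 1) / 12 * (1 - 12 * lam ^ 2) else 0
    with hK
  -- By `vir_comm` the defect `D` commutes with all modes, so it is a scalar, which is computed as a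
  -- vacuum expectation value.
  let D : Module.End ℂ Fock := vir μ lam m * vir μ lam n - vir μ lam n * vir μ lam m -
    ((m : ℂ) - n) • vir μ lam (m + n) - K • 1
  have hD (q : Fock) : D q = vir μ lam m (vir μ lam n q) - vir μ lam n (vir μ lam m q) -
    ((m : ℂ) - n) • vir μ lam (m + n) q - K • q := rfl
  have hc (k : ℤ) (q : Fock) : D (a μ k q) = a μ k (D q) := by
    simp only [hD, vir_comm, map_add, map_sub, map_smul, smul_add, smul_sub]
    rw [show k + m + n = k + n + m by ring, show k + (m + n) = k + n + m by ring]
    by_cases h : k + n + m = 0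
    · have hk : (k : ℂ) = -n - m := by
        have : k = -n - m := by omega
        rw [this]; push_cast; ring
      simp only [h, if_true]
      push_cast
      rw [hk]
      module
    · simp only [h, if_false]
      push_cast
      module
  have h0 : constantCoeff (D 1) = 0 := by
    rw [hD, map_sub, map_sub, map_sub, constantCoeff_smul, constantCoeff_smul,
      constantCoeff_vir_one]
    rcases lt_trichotomy m 0 with hm | rfl | hm <;> rcases lt_trichotomy n 0 with hn | rfl | hn
    · have h : ¬ m + n = 0 := by omega
      simp [hK, h, constantCoeff_vir_of_neg, hm, hn]
    · simp [hK, hm.ne, constantCoeff_vir_of_neg, hm, constantCoeff_vir_zero]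
    · rw [constantCoeff_vir_of_neg μ lam hm, constantCoeff_vir_vir_one μ lam hn hm, add_comm n m]
      by_cases h : m + n = 0
      · have hk : (n : ℂ) = -m := by
          have : n = -m := by omega
          rw [this]; push_cast; ring
        simp [hK, h, hk]; ring
      · simp [hK, h]
    · simp [hK, hn.ne, constantCoeff_vir_of_neg, hn, constantCoeff_vir_zero]
    · simp [hK]
    · simp [hK, hn.ne', vir_one_of_pos, hn, vir_zero_one]
    · rw [constantCoeff_vir_of_neg μ lam hn, constantCoeff_vir_vir_one μ lam hm hn]
      by_cases h : m + n = 0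
      · have hk : (n : ℂ) = -m := by
          have : n = -m := by omega
          rw [this]; push_cast; ring
        simp [hK, h, hk]; ring
      · simp [hK, h]
    · simp [hK, hm.ne', vir_one_of_pos, hm, vir_zero_one]
    · have h : ¬ m + n = 0 := by omega
      simp [hK, h, vir_one_of_pos, hm, hn]
  have h1 := eq_smul_of_commute μ D hc p
  rw [h0, zero_smul, hD, sub_sub, sub_sub, sub_eq_zero] at h1
  rw [h1]; abel

/-- The Virasoro operators in the presence of an irregular singularity: the substitution
`a₂ ↦ a₂ + s` turns `vir μ lam n` into `irrVir μ lam s n`. -/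
def irrVir (μ lam s : ℂ) (n : ℤ) : Module.End ℂ Fock :=
  vir μ lam n + s • a μ (n - 2) +
    (if n = 4 then s ^ 2 / 2 else if n = 2 then 2 * lam * s else 0) • 1

theorem irrVir_irrVir (μ lam s : ℂ) (m n : ℤ) (p : Fock) :
    irrVir μ lam s m (irrVir μ lam s n p) = irrVir μ lam s n (irrVir μ lam s m p) +
      ((m : ℂ) - n) • irrVir μ lam s (m + n) p +
      (if m + n = 0 then (m : ℂ) * ((m : ℂ) ^ 2 - 1) / 12 * (1 - 12 * lam ^ 2) else 0) • p := by
  simp only [irrVir, LinearMap.add_apply, LinearMap.smul_apply, Module.End.one_apply, map_add,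
    map_smul]
  rw [vir_vir μ lam m n p, vir_comm μ lam m (n - 2), vir_comm μ lam n (m - 2),
    a_comm μ (m - 2) (n - 2)]
  rw [show n - 2 + m = m + n - 2 by ring, show m - 2 + n = m + n - 2 by ring]
  have e1 : (m + n - 2 = 0) ↔ m + n = 2 := by omega
  have e2 : (m - 2 + (n - 2) = 0) ↔ m + n = 4 := by omega
  simp only [e1, e2]
  by_cases h4 : m + n = 4
  · have hn : (n : ℂ) = 4 - m := by
      have : n = 4 - m := by omega
      rw [this]; push_cast; ring
    simp only [h4, Int.reduceEq, if_true, if_false]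
    push_cast
    rw [hn]
    module
  · by_cases h2 : m + n = 2
    · have hn : (n : ℂ) = 2 - m := by
        have : n = 2 - m := by omega
        rw [this]; push_cast; ring
      simp only [h2, Int.reduceEq, if_true, if_false]
      push_cast
      rw [hn]
      module
    · simp only [h2, h4, if_false]
      push_cast
      module

/-- The constant `1` is a Whittaker vector for the operators `irrVir`. -/
theorem irrVir_one (μ lam s : ℂ) {n : ℤ} (hn : 2 ≤ n) : irrVir μ lam s n 1 =
    (if n = 2 then s * (μ + 2 * lam) else if n = 4 then s ^ 2 / 2 else 0) • (1 : Fock) := by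
  simp only [irrVir, LinearMap.add_apply, LinearMap.smul_apply, Module.End.one_apply,
    vir_one_of_pos μ lam (show 0 < n by omega)]
  by_cases h2 : n = 2
  · subst h2
    simp [a_zero]
    module
  · rw [a_one_of_pos μ (by omega)]
    simp [h2]

end Fock

end FreeField

/-! ### Words and PBW labels -/

/-- The degree of `Lₙ` for which the operators `Lₙ - whittakerChar ν n` respect the filtration of
the Whittaker module by `PBWIndex.deg`. -/
def letterDeg (n : ℤ) : ℤ := if n < 0 then -n else if n ≤ 4 then 2 - n else 4 - n

/-- The degree of a word in the generators. -/
def wordDeg (l : List ℤ) : ℤ := (l.map letterDeg).sum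

@[simp] theorem wordDeg_nil : wordDeg [] = 0 := rfl

@[simp] theorem wordDeg_cons (n : ℤ) (l : List ℤ) : wordDeg (n :: l) = letterDeg n + wordDeg l := by
  simp [wordDeg]

@[simp] theorem wordDeg_append (l l' : List ℤ) : wordDeg (l ++ l') = wordDeg l + wordDeg l' := by
  simp [wordDeg]

theorem wordDeg_perm {l l' : List ℤ} (h : l.Perm l') : wordDeg l = wordDeg l' :=
  (h.map letterDeg).sum_eq

/-- Reflecting all letters in `n ↦ 4 - n` changes the sign of the degree. -/
theorem wordDeg_map_reflect (l : List ℤ) (hl : ∀ n ∈ l, n ≤ 1) :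
    wordDeg (l.map (4 - ·)) = -wordDeg l := by
  induction l with
  | nil => rfl
  | cons n l ih =>
    simp only [List.mem_cons, forall_eq_or_imp] at hl
    rw [List.map_cons, wordDeg_cons, wordDeg_cons, ih hl.2]
    have h : letterDeg (4 - n) = -letterDeg n := by unfold letterDeg; split_ifs <;> omega
    rw [h]; ring

theorem card_ofRowLens (w : List ℕ) (hw : w.SortedGE) :
    (YoungDiagram.ofRowLens w hw).card = w.sum := by
  change (YoungDiagram.cellsOfRowLens w).card = w.sum
  clear hw
  induction w with
  | nil => rfl
  | cons a w ih =>
    rw [YoungDiagram.cellsOfRowLens, Finset.card_union_of_disjoint, Finset.card_map, ih]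
    · simp
    · rw [Finset.disjoint_left]
      rintro ⟨x, y⟩ h1 h2
      simp only [Finset.mem_product, Finset.mem_singleton] at h1
      simp [h1.1] at h2

theorem sum_rowLens (μ : YoungDiagram) : μ.rowLens.sum = μ.card := by
  conv_rhs => rw [← YoungDiagram.ofRowLens_to_rowLens_eq_self (μ := μ)]
  rw [card_ofRowLens]

namespace PBWIndex

/-- The indices of the generators in the PBW monomial of label `i`, from left to right. -/
def word (i : PBWIndex) : List ℤ :=
  i.shape.rowLens.map (fun p : ℕ => -(p : ℤ)) ++ List.replicate i.m₀ 0 ++ List.replicate i.m₁ 1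

theorem le_one_of_mem_word {i : PBWIndex} {n : ℤ} (hn : n ∈ i.word) : n ≤ 1 := by
  simp only [word, List.mem_append, List.mem_map, List.mem_replicate] at hn
  rcases hn with (⟨p, _, rfl⟩ | ⟨_, rfl⟩) | ⟨_, rfl⟩ <;> omega

theorem word_vac : vac.word = [] := by
  have h : (⊥ : YoungDiagram).rowLens = [] := by
    rw [List.eq_nil_iff_forall_not_mem]
    intro x hx
    have h1 := List.le_sum_of_mem hx
    rw [sum_rowLens, YoungDiagram.card, YoungDiagram.cells_bot, Finset.card_empty] at h1
    have := YoungDiagram.pos_of_mem_rowLens _ x hx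
    omega
  simp [word, vac, h]

theorem monomial_eq (i : PBWIndex) : i.monomial = (i.word.map uL).prod := by
  have h (w : List ℕ) : (w.flatMap fun a : ℕ => [(a : ℤ)]) = w.map fun a : ℕ => (a : ℤ) := by
    induction w <;> simp_all
  simp [monomial, word, Function.comp_def, mul_assoc, h]

theorem wordDeg_word (i : PBWIndex) : wordDeg i.word = i.deg := by
  have h (w : List ℕ) (hw : ∀ x ∈ w, 0 < x) :
      wordDeg (w.map fun p : ℕ => -(p : ℤ)) = (w.sum : ℕ) := by
    induction w with
    | nil => rfl
    | cons a w ih =>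
      simp only [List.mem_cons, forall_eq_or_imp] at hw
      rw [List.map_cons, wordDeg_cons, ih hw.2, List.sum_cons]
      have : -(a : ℤ) < 0 := by omega
      rw [letterDeg, if_pos this]
      push_cast
      ring
  rw [word, wordDeg_append, wordDeg_append, h _ i.shape.pos_of_mem_rowLens, sum_rowLens, deg]
  simp [wordDeg, letterDeg]
  ring

theorem eq_of_word_perm {i j : PBWIndex} (h : i.word.Perm j.word) : i = j := by
  have h0 := h.count_eq 0
  have h1 := h.count_eq 1
  have hcount (k : PBWIndex) (n : ℕ) :
      k.shape.rowLens.count (n + 1) = k.word.count (-((n : ℤ) + 1)) := by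
    have hinj : Function.Injective (fun p : ℕ => -(p : ℤ)) := fun a b h => by simpa using h
    have := List.count_map_of_injective k.shape.rowLens _ hinj (n + 1)
    have e1 : ¬ (0 : ℤ) = -((n : ℤ) + 1) := by omega
    have e2 : ¬ (1 : ℤ) = -((n : ℤ) + 1) := by omega
    rw [word, List.count_append, List.count_append, List.count_replicate, List.count_replicate]
    push_cast at this
    rw [if_neg (by simpa using e1), if_neg (by simpa using e2), this, add_zero, add_zero]
  have hz (k : PBWIndex) : k.shape.rowLens.count 0 = 0 :=
    List.count_eq_zero.mpr fun hm => absurd (k.shape.pos_of_mem_rowLens 0 hm) (lt_irrefl _)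
  have hm0 (k : PBWIndex) : k.word.count 0 = k.m₀ := by
    have e : (k.shape.rowLens.map fun p : ℕ => -(p : ℤ)).count 0 = 0 := by
      rw [List.count_eq_zero]
      intro hm
      obtain ⟨p, hp, hp0⟩ := List.mem_map.mp hm
      have := k.shape.pos_of_mem_rowLens p hp
      omega
    rw [word, List.count_append, List.count_append, e]
    simp [List.count_replicate]
  have hm1 (k : PBWIndex) : k.word.count 1 = k.m₁ := by
    have e : (k.shape.rowLens.map fun p : ℕ => -(p : ℤ)).count 1 = 0 := by
      rw [List.count_eq_zero]
      intro hm
      obtain ⟨p, hp, hp0⟩ := List.mem_map.mp hm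
      omega
    rw [word, List.count_append, List.count_append, e]
    simp [List.count_replicate]
  have hp : i.shape.rowLens.Perm j.shape.rowLens := by
    rw [List.perm_iff_count]
    rintro (_ | n)
    · rw [hz, hz]
    · rw [hcount, hcount, h.count_eq]
  have hl : i.shape.rowLens = j.shape.rowLens :=
    hp.eq_of_pairwise' i.shape.rowLens_sorted.pairwise j.shape.rowLens_sorted.pairwise
  have hs : i.shape = j.shape :=
    YoungDiagram.equivListRowLens.injective (Subtype.ext hl)
  rw [hm0, hm0] at h0
  rw [hm1, hm1] at h1
  cases i; cases j; simp_all

theorem exists_perm_word (l : List ℤ) (hl : ∀ n ∈ l, n ≤ 1) : ∃ i : PBWIndex, l.Perm i.word := by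
  set w : List ℕ := ((l.filter (· < 0)).map fun n => (-n).toNat).mergeSort (· ≥ ·) with hw
  have hperm : w.Perm ((l.filter (· < 0)).map fun n => (-n).toNat) := List.mergeSort_perm _ _
  have hsort : w.SortedGE := by
    rw [List.sortedGE_iff_pairwise]
    have := List.pairwise_mergeSort (le := fun a b : ℕ => decide (a ≥ b))
      (by intro a b c; simp; omega) (by intro a b; simp; omega)
      ((l.filter (· < 0)).map fun n => (-n).toNat)
    simpa using this
  have hpos : ∀ x ∈ w, 0 < x := by
    intro x hx
    rw [hperm.mem_iff, List.mem_map] at hx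
    obtain ⟨n, hn, rfl⟩ := hx
    simp only [List.mem_filter, decide_eq_true_eq] at hn
    omega
  refine ⟨⟨YoungDiagram.ofRowLens w hsort, l.count 0, l.count 1⟩, ?_⟩
  rw [word, YoungDiagram.rowLens_ofRowLens_eq_self hpos]
  have h1 : (w.map fun p : ℕ => -(p : ℤ)).Perm (l.filter (· < 0)) := by
    refine (hperm.map _).trans ?_
    rw [List.map_map]
    refine List.Perm.of_eq ((List.map_congr_left ?_).trans (List.map_id _))
    intro n hn
    simp only [List.mem_filter, decide_eq_true_eq] at hn
    simp only [Function.comp_apply, id]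
    omega
  rw [List.perm_iff_count]
  intro n
  rw [List.count_append, List.count_append, h1.count_eq, List.count_replicate, List.count_replicate]
  by_cases h0 : n < 0
  · rw [List.count_filter (by simpa using h0)]
    have e1 : ¬ 0 = n := by omega
    have e2 : ¬ 1 = n := by omega
    simp [e1, e2]
  · have hf : (l.filter (· < 0)).count n = 0 :=
      List.count_eq_zero.mpr fun h => h0 (by simpa using (List.mem_filter.mp h).2)
    rw [hf]
    by_cases h2 : n ≤ 1
    · obtain rfl | rfl : n = 0 ∨ n = 1 := by omega
      · simp
      · simp
    · have e1 : ¬ 0 = n := by omega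
      have e2 : ¬ 1 = n := by omega
      simp [e1, e2, List.count_eq_zero.mpr (fun h => h2 (hl n h))]

theorem eq_vac_of_deg_eq_zero {i : PBWIndex} (h : i.deg = 0) : i = vac := by
  obtain ⟨s, m₀, m₁⟩ := i
  simp only [deg] at h
  have hs : s = ⊥ := YoungDiagram.ext (Finset.card_eq_zero.mp (show s.card = 0 by omega))
  obtain rfl : m₀ = 0 := by omega
  obtain rfl : m₁ = 0 := by omega
  rw [hs]; rfl

theorem length_le_wordDeg {l : List ℤ} (hl : ∀ n ∈ l, n ≤ 1) : (l.length : ℤ) ≤ wordDeg l ∧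
    ∀ n ∈ l, -n ≤ wordDeg l := by
  induction l with
  | nil => simp
  | cons n l ih =>
    simp only [List.mem_cons, forall_eq_or_imp] at hl
    obtain ⟨h1, h2⟩ := ih hl.2
    have h3 : 1 ≤ letterDeg n ∧ -n ≤ letterDeg n := by unfold letterDeg; split_ifs <;> omega
    simp only [List.length_cons, wordDeg_cons, List.mem_cons, forall_eq_or_imp]
    push_cast
    refine ⟨by omega, by omega, fun x hx => ?_⟩
    have := h2 x hx
    omega

theorem finite_deg_le (k : ℕ) : {i : PBWIndex | i.deg ≤ k}.Finite := by
  have hinj : Function.Injective word := fun i j h => eq_of_word_perm (List.Perm.of_eq h)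
  have hfin : (List.map (Subtype.val : Set.Icc (-(k : ℤ)) 1 → ℤ) ''
      {l | l.length ≤ k}).Finite := (List.finite_length_le _ k).image _
  refine Set.Finite.of_finite_image (hfin.subset ?_) hinj.injOn
  rintro _ ⟨i, hi, rfl⟩
  have hd := wordDeg_word i
  obtain ⟨h1, h2⟩ := length_le_wordDeg (l := i.word) fun n hn => le_one_of_mem_word hn
  simp only [Set.mem_ofPred_eq] at hi
  have hmem : ∀ n ∈ i.word, n ∈ Set.Icc (-(k : ℤ)) 1 := fun n hn =>
    ⟨by have := h2 n hn; omega, le_one_of_mem_word hn⟩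
  refine ⟨i.word.attachWith _ hmem, ?_, by simp⟩
  simp only [Set.mem_ofPred_eq, List.length_attachWith]
  omega

end PBWIndex

section Weight

open MvPolynomial

namespace Fock

/-! ### The weight filtration of the Fock space -/

/-- The weight of a monomial, the variable `X k` having weight `k + 1`. -/
def wt : (ℕ →₀ ℕ) →+ ℕ := Finsupp.weight fun k => k + 1

theorem wt_single (k e : ℕ) : wt (Finsupp.single k e) = e * (k + 1) := by
  simp [wt, Finsupp.weight_apply]

/-- The polynomials of weight at most `d`. -/
def wtLE (d : ℤ) : Submodule ℂ Fock where
  carrier := {p | ∀ m, coeff m p ≠ 0 → (wt m : ℤ) ≤ d}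
  zero_mem' := by simp
  add_mem' := by
    intro p q hp hq m hm
    rw [coeff_add] at hm
    by_cases h : coeff m p = 0
    · exact hq m fun h' => hm (by rw [h, h', add_zero])
    · exact hp m h
  smul_mem' := by
    intro r p hp m hm
    exact hp m fun h => hm (by rw [coeff_smul, h, smul_zero])

theorem wtLE_mono {d e : ℤ} (h : d ≤ e) : wtLE d ≤ wtLE e := fun _ hp m hm => (hp m hm).trans h

theorem monomial_mem_wtLE {m : ℕ →₀ ℕ} {d : ℤ} (h : (wt m : ℤ) ≤ d) (r : ℂ) :
    monomial m r ∈ wtLE d := by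
  intro m' hm'
  rw [coeff_monomial] at hm'
  split_ifs at hm' with he
  · rwa [← he]
  · exact absurd rfl hm'

theorem monomial_mul_mem_wtLE (m : ℕ →₀ ℕ) {p : Fock} {d : ℤ} (hp : p ∈ wtLE d) :
    monomial m (1 : ℂ) * p ∈ wtLE (wt m + d) := by
  intro m' hm'
  rw [coeff_monomial_mul'] at hm'
  split_ifs at hm' with h
  · rw [one_mul] at hm'
    have h1 := hp _ hm'
    rw [← add_tsub_cancel_of_le h, map_add]
    push_cast
    omega
  · exact absurd rfl hm'

theorem X_mul_mem_wtLE (k : ℕ) {p : Fock} {d : ℤ} (hp : p ∈ wtLE d) :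
    X k * p ∈ wtLE (d + k + 1) := by
  refine wtLE_mono ?_ (monomial_mul_mem_wtLE (Finsupp.single k 1) hp)
  rw [wt_single]
  push_cast
  omega

/-- An operator changes weights by at most `e` as soon as it does so on monomials. -/
theorem map_mem_wtLE (T : Module.End ℂ Fock) (e : ℤ)
    (hT : ∀ m, T (monomial m 1) ∈ wtLE (wt m + e)) {p : Fock} {d : ℤ} (hp : p ∈ wtLE d) :
    T p ∈ wtLE (d + e) := by
  rw [p.as_sum, map_sum]
  refine Submodule.sum_mem _ fun m hm => ?_
  rw [show monomial m (coeff m p) = coeff m p • monomial m (1 : ℂ) by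
    rw [smul_monomial, smul_eq_mul, mul_one], map_smul]
  refine Submodule.smul_mem _ _ (wtLE_mono ?_ (hT m))
  have := hp m (mem_support_iff.mp hm)
  omega

theorem a_mem_wtLE (μ : ℂ) (n : ℤ) {p : Fock} {d : ℤ} (hp : p ∈ wtLE d) :
    a μ n p ∈ wtLE (d - n) := by
  rcases int_cases n with rfl | ⟨k, rfl⟩ | ⟨k, rfl⟩
  · rw [sub_zero, a_zero]
    exact Submodule.smul_mem _ _ hp
  · rw [a_pos]
    refine Submodule.smul_mem _ _ fun m hm => ?_
    rw [coeff_pderiv] at hm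
    have := hp _ (left_ne_zero_of_mul hm)
    rw [map_add, wt_single] at this
    push_cast at this
    omega
  · rw [a_neg]
    exact wtLE_mono (by omega) (X_mul_mem_wtLE k hp)

theorem derivPart_mem_wtLE (n : ℤ) {p : Fock} {d : ℤ} (hp : p ∈ wtLE d) :
    derivPart n p ∈ wtLE (d - n) := by
  refine map_mem_wtLE (derivPart n).toLinearMap (-n) (fun m => ?_) hp
  rw [Derivation.coeFn_coe]
  induction m using Finsupp.induction_linear with
  | zero =>
    rw [show (monomial (0 : ℕ →₀ ℕ) (1 : ℂ) : Fock) = 1 from rfl, Derivation.map_one_eq_zero]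
    exact Submodule.zero_mem _
  | add f g hf hg =>
    rw [show monomial (f + g) (1 : ℂ) = monomial f 1 * monomial g 1 by
      rw [monomial_mul, one_mul], Derivation.leibniz, smul_eq_mul, smul_eq_mul, map_add]
    push_cast
    exact Submodule.add_mem _ (wtLE_mono (by omega) (monomial_mul_mem_wtLE f hg))
      (wtLE_mono (by omega) (monomial_mul_mem_wtLE g hf))
  | single k e =>
    rcases e with _ | e
    · rw [Finsupp.single_zero, show (monomial (0 : ℕ →₀ ℕ) (1 : ℂ) : Fock) = 1 from rfl,
        Derivation.map_one_eq_zero]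
      exact Submodule.zero_mem _
    rw [show monomial (Finsupp.single k (e + 1)) (1 : ℂ) = X k ^ (e + 1) from
        X_pow_eq_monomial.symm,
      Derivation.leibniz_pow, derivPart_X, X_pow_eq_monomial, smul_eq_mul, wt_single]
    refine Submodule.smul_of_tower_mem _ _ ?_
    split_ifs with hk
    · rw [mul_smul_comm]
      refine Submodule.smul_mem _ _ ?_
      refine wtLE_mono ?_ (monomial_mul_mem_wtLE _
        (monomial_mem_wtLE (m := Finsupp.single _ 1) le_rfl 1))
      rw [wt_single, wt_single, Nat.add_sub_cancel]
      push_cast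
      rw [Int.toNat_of_nonneg (by omega)]
      linarith
    · rw [mul_zero]
      exact Submodule.zero_mem _

theorem quadPart_mem_wtLE (μ : ℂ) (n : ℤ) {p : Fock} {d : ℤ} (hp : p ∈ wtLE d) :
    quadPart μ n p ∈ wtLE (d - n) := by
  simp only [quadPart, LinearMap.smul_apply, LinearMap.sum_apply]
  refine Submodule.smul_mem _ _ (Submodule.sum_mem _ fun i _ => ?_)
  exact wtLE_mono (by omega) (a_mem_wtLE μ i (a_mem_wtLE μ (n - i) hp))

theorem linPart_mem_wtLE (μ lam : ℂ) (n : ℤ) {p : Fock} {d : ℤ} (hp : p ∈ wtLE d) :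
    linPart μ lam n p ∈ wtLE (d - n) := by
  unfold linPart
  split_ifs with h
  · exact Submodule.smul_mem _ _ (wtLE_mono (by omega) hp)
  · exact Submodule.smul_mem _ _ (a_mem_wtLE μ n hp)

theorem vir_mem_wtLE (μ lam : ℂ) (n : ℤ) {p : Fock} {d : ℤ} (hp : p ∈ wtLE d) :
    vir μ lam n p ∈ wtLE (d - n) :=
  Submodule.add_mem _ (Submodule.add_mem _ (derivPart_mem_wtLE n hp) (quadPart_mem_wtLE μ n hp))
    (linPart_mem_wtLE μ lam n hp)

/-- The exponent of the leading monomial of a product of operators `irrVir μ lam s n`, `n ≤ 1`,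
applied to `1`: each factor contributes the variable that represents `aₙ₋₂`. -/
def leadExp (l : List ℤ) : ℕ →₀ ℕ := (l.map fun n => Finsupp.single (1 - n).toNat 1).sum

theorem leadExp_cons (n : ℤ) (l : List ℤ) :
    leadExp (n :: l) = Finsupp.single (1 - n).toNat 1 + leadExp l := by simp [leadExp]

theorem leadExp_apply {l : List ℤ} (hl : ∀ n ∈ l, n ≤ 1) (k : ℕ) :
    leadExp l k = l.count (1 - k : ℤ) := by
  induction l with
  | nil => rfl
  | cons n l ih =>
    simp only [List.mem_cons, forall_eq_or_imp] at hl
    rw [leadExp_cons, Finsupp.add_apply, ih hl.2, List.count_cons, Finsupp.single_apply, add_comm]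
    have : ((1 - n).toNat = k) ↔ n = 1 - k := by omega
    simp [this]

theorem leadExp_word_injective : Function.Injective fun i : PBWIndex => leadExp i.word := by
  intro i j h
  refine PBWIndex.eq_of_word_perm (List.perm_iff_count.mpr fun n => ?_)
  by_cases hn : n ≤ 1
  · have := DFunLike.congr_fun h (1 - n).toNat
    simp only at this
    rw [leadExp_apply fun _ => PBWIndex.le_one_of_mem_word,
      leadExp_apply fun _ => PBWIndex.le_one_of_mem_word,
      show (1 : ℤ) - (1 - n).toNat = n by omega] at this
    exact this
  · rw [List.count_eq_zero.mpr fun h => hn (PBWIndex.le_one_of_mem_word h),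
      List.count_eq_zero.mpr fun h => hn (PBWIndex.le_one_of_mem_word h)]

theorem irrVir_prod_sub_mem (μ lam s : ℂ) {l : List ℤ} (hl : ∀ n ∈ l, n ≤ 1) :
    (l.map (irrVir μ lam s)).prod 1 - s ^ l.length • monomial (leadExp l) (1 : ℂ) ∈
      wtLE (wt (leadExp l) - 1) := by
  induction l with
  | nil =>
    have : (monomial (leadExp []) (1 : ℂ) : Fock) = 1 := rfl
    simp [this]
  | cons n l ih =>
    simp only [List.mem_cons, forall_eq_or_imp] at hl
    have ih := ih hl.2
    set q : Fock := (l.map (irrVir μ lam s)).prod 1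
    have hq : q ∈ wtLE (wt (leadExp l)) := by
      have := Submodule.add_mem _ (wtLE_mono (by omega) ih)
        (Submodule.smul_mem _ (s ^ l.length) (monomial_mem_wtLE (le_refl (wt (leadExp l) : ℤ)) 1))
      rwa [sub_add_cancel] at this
    have hw : (wt (leadExp (n :: l)) : ℤ) = wt (leadExp l) + (2 - n) := by
      rw [leadExp_cons, map_add, wt_single]; push_cast; omega
    have ha (p : Fock) : a μ (n - 2) p = X (1 - n).toNat * p := by
      rw [show n - 2 = -(((1 - n).toNat : ℤ) + 1) by omega, a_neg]
    have hmon : monomial (leadExp (n :: l)) (1 : ℂ) =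
        X (1 - n).toNat * monomial (leadExp l) (1 : ℂ) := by
      rw [leadExp_cons, X, monomial_mul, one_mul]
    have e : irrVir μ lam s n q - s ^ (l.length + 1) • monomial (leadExp (n :: l)) (1 : ℂ) =
        vir μ lam n q + s • a μ (n - 2) (q - s ^ l.length • monomial (leadExp l) (1 : ℂ)) := by
      have h4 : ¬ n = 4 := by omega
      have h2 : ¬ n = 2 := by omega
      simp only [irrVir, LinearMap.add_apply, LinearMap.smul_apply, h4, h2, if_false, zero_smul,
        LinearMap.zero_apply, ha, hmon, mul_sub, mul_smul_comm, smul_sub, pow_succ', mul_smul]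
      abel
    rw [List.map_cons, List.prod_cons, Module.End.mul_apply, List.length_cons, e, hw]
    exact Submodule.add_mem _ (wtLE_mono (by omega) (vir_mem_wtLE μ lam n hq))
      (Submodule.smul_mem _ _ (wtLE_mono (by omega) (a_mem_wtLE μ (n - 2) ih)))

/-- The PBW monomials applied to `1` have distinct leading monomials. -/
theorem linearIndependent_irrVir (μ lam : ℂ) {s : ℂ} (hs : s ≠ 0) :
    LinearIndependent ℂ fun i : PBWIndex => (i.word.map (irrVir μ lam s)).prod (1 : Fock) := by
  classical
  rw [linearIndependent_iff']
  intro S g hg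
  by_contra! hne
  obtain ⟨i, hi, hmax⟩ := (S.filter (g · ≠ 0)).exists_max_image (fun i => wt (leadExp i.word))
    (by obtain ⟨i, hi, hgi⟩ := hne; exact ⟨i, by simp [hi, hgi]⟩)
  rw [Finset.mem_filter] at hi
  have hc (j : PBWIndex) (hj : j ∈ S) :
      g j * coeff (leadExp i.word) ((j.word.map (irrVir μ lam s)).prod (1 : Fock)) =
        if j = i then g i * s ^ i.word.length else 0 := by
    by_cases hgj : g j = 0
    · have hji : j ≠ i := by rintro rfl; exact hi.2 hgj
      simp [hgj, hji]
    have h1 := irrVir_prod_sub_mem μ lam s (l := j.word) fun _ => PBWIndex.le_one_of_mem_word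
    have h2 : coeff (leadExp i.word) ((j.word.map (irrVir μ lam s)).prod (1 : Fock)) =
        coeff (leadExp i.word) (s ^ j.word.length • monomial (leadExp j.word) (1 : ℂ)) := by
      rw [← sub_eq_zero, ← coeff_sub]
      by_contra hne
      have h3 := h1 _ hne
      have h4 := hmax j (by simp [hj, hgj])
      omega
    rw [h2, coeff_smul, coeff_monomial]
    by_cases hji : j = i
    · simp [hji]
    · have : leadExp j.word ≠ leadExp i.word := fun h => hji (leadExp_word_injective h)
      simp [hji, this]
  have h0 := congrArg (coeff (leadExp i.word)) hg
  rw [coeff_sum] at h0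
  simp only [coeff_smul, smul_eq_mul, coeff_zero] at h0
  rw [Finset.sum_congr rfl hc, Finset.sum_ite_eq' S i, if_pos hi.1] at h0
  exact mul_ne_zero hi.2 (pow_ne_zero _ hs) h0

/-- For `n ≥ 3` the shifted operator lowers the weight: its leading part is the annihilation
operator `aₙ₋₂`. -/
theorem irrVir_sub_eq (μ lam s : ℂ) {n : ℤ} (hn : 3 ≤ n) (p : Fock) :
    irrVir μ lam s n p - (if n = 4 then s ^ 2 / 2 else 0 : ℂ) • p =
      vir μ lam n p + s • a μ (n - 2) p := by
  have h2 : ¬ n = 2 := by omega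
  simp only [irrVir, h2, if_false, LinearMap.add_apply, LinearMap.smul_apply, Module.End.one_apply,
    add_sub_cancel_right]

theorem irrVir_sub_mem_wtLE (μ lam s : ℂ) {n : ℤ} (hn : 3 ≤ n) {p : Fock} {d : ℤ}
    (hp : p ∈ wtLE d) :
    irrVir μ lam s n p - (if n = 4 then s ^ 2 / 2 else 0 : ℂ) • p ∈ wtLE (d - 1) := by
  rw [irrVir_sub_eq μ lam s hn]
  exact Submodule.add_mem _ (wtLE_mono (by omega) (vir_mem_wtLE μ lam n hp))
    (Submodule.smul_mem _ _ (wtLE_mono (by omega) (a_mem_wtLE μ (n - 2) hp)))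

/-- Only constants are Whittaker vectors for the `Lₙ` with `n ≥ 3`. -/
theorem eq_C_of_irrVir (μ lam : ℂ) {s : ℂ} (hs : s ≠ 0) (p : Fock)
    (h : ∀ n : ℤ, 3 ≤ n → irrVir μ lam s n p = (if n = 4 then s ^ 2 / 2 else 0 : ℂ) • p) :
    p = constantCoeff p • (1 : Fock) := by
  rcases eq_or_ne p 0 with rfl | hp
  · simp
  obtain ⟨m, hm, hmax⟩ := p.support.exists_max_image wt (support_nonempty.mpr hp)
  have hpW : p ∈ wtLE (wt m) := fun m' hm' => by
    exact_mod_cast hmax m' (mem_support_iff.mpr hm')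
  have hm0 : m = 0 := by
    by_contra hm0
    obtain ⟨k, hk⟩ : ∃ k, m k ≠ 0 := by
      by_contra! hc; exact hm0 (Finsupp.ext fun i => by simp [hc i])
    have hsub : m - Finsupp.single k 1 + Finsupp.single k 1 = m :=
      tsub_add_cancel_of_le (by simpa [Nat.one_le_iff_ne_zero] using hk)
    have hw : wt m = wt (m - Finsupp.single k 1) + (k + 1) := by
      conv_lhs => rw [← hsub, map_add, wt_single, one_mul]
    -- Compare the coefficients at `m` lowered in the variable `X k`: by weight, only the derivative
    -- of the monomial `m` of top weight contributes.
    have h1 := irrVir_sub_eq μ lam s (n := k + 3) (by omega) p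
    rw [h _ (by omega), sub_self, show (k : ℤ) + 3 - 2 = k + 1 by ring, a_pos] at h1
    have h2 := congrArg (coeff (m - Finsupp.single k 1)) h1
    rw [coeff_zero, coeff_add, coeff_smul, coeff_smul, coeff_pderiv, hsub] at h2
    have h3 : coeff (m - Finsupp.single k 1) (vir μ lam (k + 3) p) = 0 := by
      by_contra hne
      have := vir_mem_wtLE μ lam (k + 3) hpW _ hne
      omega
    rw [h3, zero_add] at h2
    exact mul_ne_zero hs (mul_ne_zero (Nat.cast_add_one_ne_zero k)
      (mul_ne_zero (mem_support_iff.mp hm) (Nat.cast_add_one_ne_zero _))) h2.symm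
  subst hm0
  ext m'
  rw [coeff_smul, coeff_one, constantCoeff_eq]
  by_cases hm' : 0 = m'
  · simp [← hm']
  · have : coeff m' p = 0 := by
      by_contra hne
      have h1 := hpW m' hne
      rw [map_zero] at h1
      obtain ⟨k, hk⟩ : ∃ k, m' k ≠ 0 := by
        by_contra! hc; exact hm' (Finsupp.ext fun i => by simp [hc i])
      have hsub : m' - Finsupp.single k 1 + Finsupp.single k 1 = m' :=
        tsub_add_cancel_of_le (by simpa [Nat.one_le_iff_ne_zero] using hk)
      rw [← hsub, map_add, wt_single] at h1
      push_cast at h1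
      omega
    simp [this, hm']

theorem exists_mem_wtLE (p : Fock) : ∃ d : ℕ, p ∈ wtLE d :=
  ⟨p.support.sup wt, fun m hm => by
    exact_mod_cast Finset.le_sup (f := wt) (mem_support_iff.mpr hm)⟩

theorem eq_zero_of_mem_wtLE_neg {p : Fock} {d : ℤ} (hd : d < 0) (hp : p ∈ wtLE d) : p = 0 := by
  ext m
  by_contra hne
  have := hp m hne
  omega

end Fock

end Weight

/-! ### The enveloping algebra -/

-- `UniversalEnvelopingAlgebra.ι` and `lift` refer to the commutator bracket, which is not a global
-- instance.
attribute [local instance] LieRing.ofAssociativeRing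

theorem snd_add (x y : Virasoro) : (x + y).2 = x.2 + y.2 := rfl

theorem snd_smul (t : ℂ) (x : Virasoro) : (t • x).2 = t • x.2 := rfl

theorem eq_linearCombination_add (x : Virasoro) :
    x = Finsupp.linearCombination ℂ L x.1 + x.2 • C := by
  have h (f : ℤ →₀ ℂ) : Finsupp.linearCombination ℂ L f = (f, (0 : ℂ)) := by
    induction f using Finsupp.induction_linear with
    | zero => rw [map_zero]; rfl
    | add f g hf hg =>
      rw [map_add, hf, hg]
      exact Prod.ext rfl (add_zero (0 : ℂ))
    | single n t =>
      rw [Finsupp.linearCombination_single]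
      refine Prod.ext ?_ (mul_zero t)
      change t • Finsupp.single n (1 : ℂ) = _
      rw [Finsupp.smul_single, smul_eq_mul, mul_one]
  rw [h]
  refine Prod.ext ?_ ?_
  · change x.1 = x.1 + x.2 • (0 : ℤ →₀ ℂ)
    rw [smul_zero, add_zero]
  · change x.2 = 0 + x.2 * 1
    ring

/-- `U(Vir)` is generated by the `Lₙ` and by `C`. -/
theorem mem_of_generators (S : Subalgebra ℂ U) (hL : ∀ n, uL n ∈ S) (hC : uC ∈ S) (u : U) :
    u ∈ S := by
  have hι (x : Virasoro) : UniversalEnvelopingAlgebra.ι ℂ x ∈ S := by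
    rw [eq_linearCombination_add x, map_add, map_smul]
    refine add_mem ?_ (S.smul_mem hC _)
    induction x.1 using Finsupp.induction_linear with
    | zero => rw [map_zero, map_zero]; exact zero_mem S
    | add f g hf hg => rw [map_add, map_add]; exact add_mem hf hg
    | single n t =>
      rw [Finsupp.linearCombination_single, map_smul]
      exact S.smul_mem (hL n) _
  let f : Virasoro →ₗ⁅ℂ⁆ S :=
    { toFun := fun x => ⟨UniversalEnvelopingAlgebra.ι ℂ x, hι x⟩
      map_add' := fun x y => Subtype.ext (map_add _ x y)
      map_smul' := fun t x => Subtype.ext (map_smul _ t x)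
      map_lie' := fun {x y} => Subtype.ext (LieHom.map_lie _ x y) }
  have h : S.val.comp (UniversalEnvelopingAlgebra.lift ℂ f) = AlgHom.id ℂ U := by
    apply UniversalEnvelopingAlgebra.hom_ext
    ext x
    simp [f]
  have := congrArg (fun g : U →ₐ[ℂ] U => g u) h
  simp only [AlgHom.comp_apply, AlgHom.id_apply] at this
  rw [← this]
  exact Subtype.property _

theorem uL_mul_uL (m n : ℤ) : uL m * uL n = uL n * uL m + ((m : ℂ) - n) • uL (m + n) +
    (if m + n = 0 then (m : ℂ) * ((m : ℂ) ^ 2 - 1) / 12 else 0) • uC := by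
  have h := LieHom.map_lie (UniversalEnvelopingAlgebra.ι ℂ) (L m) (L n)
  rw [lie_L_L, map_add, map_smul, map_smul, Ring.lie_def] at h
  change _ = uL m * uL n - uL n * uL m at h
  rw [eq_sub_iff_add_eq] at h
  rw [← h]
  change _ = _ + _ • UniversalEnvelopingAlgebra.ι ℂ _ + _ • UniversalEnvelopingAlgebra.ι ℂ _
  abel

theorem uC_mul (u : U) : uC * u = u * uC := by
  have h : u ∈ Subalgebra.centralizer ℂ {uC} := by
    have hι (x : Virasoro) : UniversalEnvelopingAlgebra.ι ℂ x * uC =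
        uC * UniversalEnvelopingAlgebra.ι ℂ x := by
      have h := LieHom.map_lie (UniversalEnvelopingAlgebra.ι ℂ) x C
      rw [lie_C, map_zero, Ring.lie_def] at h
      exact (sub_eq_zero.mp h.symm)
    refine mem_of_generators _ (fun n => ?_) ?_ u
    · rw [Subalgebra.mem_centralizer_iff]
      rintro _ rfl
      exact (hι (L n)).symm
    · simp [Subalgebra.mem_centralizer_iff]
  simpa [Subalgebra.mem_centralizer_iff] using h

/-! ### The free field realization of the Whittaker module -/

/-- The representation of the Virasoro algebra on the Fock space by the operators `irrVir`. -/
def fockRep (μ lam s : ℂ) : Virasoro →ₗ⁅ℂ⁆ Module.End ℂ Fock where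
  toFun x := Finsupp.linearCombination ℂ (Fock.irrVir μ lam s) x.1 +
    (x.2 * (1 - 12 * lam ^ 2)) • 1
  map_add' x y := by rw [fst_add, snd_add, map_add]; module
  map_smul' t x := by
    rw [fst_smul, snd_smul, map_smul, smul_eq_mul, RingHom.id_apply]
    module
  map_lie' := by
    intro x y
    have key (f g : ℤ →₀ ℂ) : Finsupp.linearCombination ℂ (Fock.irrVir μ lam s) (bracketAux f g).1 +
        ((bracketAux f g).2 * (1 - 12 * lam ^ 2)) • (1 : Module.End ℂ Fock) =
        ⁅Finsupp.linearCombination ℂ (Fock.irrVir μ lam s) f,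
          Finsupp.linearCombination ℂ (Fock.irrVir μ lam s) g⁆ := by
      induction f using Finsupp.induction_linear with
      | zero =>
        rw [map_zero, LinearMap.zero_apply, map_zero, zero_lie, fst_zero, map_zero,
          show (0 : Virasoro).2 = 0 from rfl]
        simp
      | add f₁ f₂ h₁ h₂ =>
        rw [map_add, LinearMap.add_apply, map_add, add_lie, fst_add, snd_add, ← h₁, ← h₂, map_add]
        module
      | single m r =>
        induction g using Finsupp.induction_linear with
        | zero =>
          rw [map_zero, map_zero, lie_zero, fst_zero, map_zero,
            show (0 : Virasoro).2 = 0 from rfl]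
          simp
        | add f₁ f₂ h₁ h₂ =>
          rw [map_add, map_add, lie_add, fst_add, snd_add, ← h₁, ← h₂, map_add]
          module
        | single n t =>
          have e2 : (bracketGen m n).2 =
              if m + n = 0 then (m : ℂ) * ((m : ℂ) ^ 2 - 1) / 12 else 0 := by
            change _ * (0 : ℂ) + _ * (1 : ℂ) = _
            ring
          rw [bracketAux_single, fst_smul, snd_smul, fst_bracketGen, map_smul, e2,
            Finsupp.linearCombination_single, Finsupp.linearCombination_single,
            Finsupp.linearCombination_single, Ring.lie_def]
          refine LinearMap.ext fun p => ?_
          have h := Fock.irrVir_irrVir μ lam s m n p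
          simp only [LinearMap.add_apply, LinearMap.sub_apply, LinearMap.smul_apply,
            Module.End.mul_apply, Module.End.one_apply, map_smul, h, smul_eq_mul]
          split_ifs <;> module
    rw [bracket_def, key, Ring.lie_def, Ring.lie_def]
    simp only [add_mul, mul_add, smul_mul_assoc, mul_smul_comm, one_mul, mul_one, smul_add]
    rw [smul_comm (x.2 * _) (y.2 * _)]
    abel

theorem fockRep_L (μ lam s : ℂ) (n : ℤ) : fockRep μ lam s (L n) = Fock.irrVir μ lam s n := by
  change Finsupp.linearCombination ℂ (Fock.irrVir μ lam s) (Finsupp.single n 1) +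
    ((0 : ℂ) * _) • 1 = _
  simp

theorem fockRep_C (μ lam s : ℂ) :
    fockRep μ lam s C = (1 - 12 * lam ^ 2) • (1 : Module.End ℂ Fock) := by
  change Finsupp.linearCombination ℂ (Fock.irrVir μ lam s) 0 + ((1 : ℂ) * _) • 1 = _
  simp

/-- The universal property of the Whittaker module, for the vacuum of the Fock space with parameters
adjusted to `c` and `ν`: the free field realization. -/
theorem exists_freeField (c ν : ℂ) : ∃ (μ lam s : ℂ) (f : WhittakerModule c ν →ₗ[ℂ] Fock),
    s ^ 2 = 1 / 2 ∧ f (J c ν) = 1 ∧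
      ∀ (n : ℤ) (v : WhittakerModule c ν), f (uL n • v) = Fock.irrVir μ lam s n (f v) := by
  -- The central charge fixes the background charge `lam`, `L₄ ↦ 1/4` fixes the shift `s`, and
  -- `L₂ ↦ -ν` then fixes the momentum `μ`.
  obtain ⟨lam, hlam⟩ := IsAlgClosed.exists_pow_nat_eq ((1 - c) / 12) (n := 2) (by norm_num)
  obtain ⟨s, hs⟩ := IsAlgClosed.exists_pow_nat_eq (1 / 2 : ℂ) (n := 2) (by norm_num)
  have hs0 : s ≠ 0 := by rintro rfl; norm_num at hs
  set μ : ℂ := -ν / s - 2 * lam with hμ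
  let A : U →ₐ[ℂ] Module.End ℂ Fock := UniversalEnvelopingAlgebra.lift ℂ (fockRep μ lam s)
  have hAL (n : ℤ) : A (uL n) = Fock.irrVir μ lam s n := by
    rw [← fockRep_L]; exact UniversalEnvelopingAlgebra.lift_ι_apply ℂ _ _
  have hAC : A uC = (1 - 12 * lam ^ 2) • (1 : Module.End ℂ Fock) := by
    rw [← fockRep_C μ lam s]; exact UniversalEnvelopingAlgebra.lift_ι_apply ℂ _ _
  let ev : U →ₗ[ℂ] Fock := (LinearMap.applyₗ (1 : Fock)) ∘ₗ A.toLinearMap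
  let K : Submodule U U :=
    { carrier := {u | A u 1 = 0}
      zero_mem' := by simp
      add_mem' := by
        intro u v hu hv
        simp only [Set.mem_ofPred_eq] at hu hv ⊢
        rw [map_add, LinearMap.add_apply, hu, hv, add_zero]
      smul_mem' := by
        intro u v hv
        simp only [Set.mem_ofPred_eq] at hv ⊢
        rw [smul_eq_mul, map_mul, Module.End.mul_apply, hv, map_zero] }
  have hK : whittakerIdeal c ν ≤ K := by
    refine Submodule.span_le.mpr ?_
    rintro u (rfl | ⟨n, hn, rfl⟩)
    · change A _ 1 = 0
      rw [map_sub, hAC, AlgHom.commutes, hlam, Module.algebraMap_end_eq_smul_id]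
      simp only [LinearMap.sub_apply, LinearMap.smul_apply, Module.End.one_apply,
        LinearMap.id_apply]
      rw [← sub_smul, show 1 - 12 * ((1 - c) / 12) - c = 0 by ring, zero_smul]
    · change A _ 1 = 0
      rw [map_sub, hAL, AlgHom.commutes, Module.algebraMap_end_eq_smul_id, LinearMap.sub_apply,
        LinearMap.smul_apply, LinearMap.id_apply, Fock.irrVir_one μ lam s hn, ← sub_smul, hs,
        whittakerChar, show s * (μ + 2 * lam) = -ν by rw [hμ]; field_simp; ring]
      norm_num
  have hle : (whittakerIdeal c ν).restrictScalars ℂ ≤ LinearMap.ker ev := fun u hu => hK hu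
  let f : WhittakerModule c ν →ₗ[ℂ] Fock := Submodule.liftQ _ ev hle ∘ₗ
    (Submodule.Quotient.restrictScalarsEquiv ℂ (whittakerIdeal c ν)).symm.toLinearMap
  have hf (u : U) : f (Submodule.Quotient.mk u) = A u 1 := rfl
  refine ⟨μ, lam, s, f, hs, ?_, fun n v => ?_⟩
  · rw [J, hf, map_one A, Module.End.one_apply]
  · induction v using Submodule.Quotient.induction_on with
    | _ u =>
      rw [← Submodule.Quotient.mk_smul, hf, hf, smul_eq_mul, map_mul, hAL, Module.End.mul_apply]

/-! ### Words in the shifted generators -/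

/-- The shifted generator `Lₙ - whittakerChar ν n`, which annihilates `|J⟩` for `n ≥ 2`. -/
def shiftL (ν : ℂ) (n : ℤ) : U := uL n - algebraMap ℂ U (whittakerChar ν n)

/-- The product of the shifted generators with indices in a list. -/
def shiftWord (ν : ℂ) (l : List ℤ) : U := (l.map (shiftL ν)).prod

theorem shiftWord_nil (ν : ℂ) : shiftWord ν [] = 1 := rfl

theorem shiftWord_cons (ν : ℂ) (n : ℤ) (l : List ℤ) :
    shiftWord ν (n :: l) = shiftL ν n * shiftWord ν l := by simp [shiftWord]

theorem shiftWord_append (ν : ℂ) (l l' : List ℤ) :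
    shiftWord ν (l ++ l') = shiftWord ν l * shiftWord ν l' := by simp [shiftWord]

theorem whittakerChar_of_le_one (ν : ℂ) {n : ℤ} (hn : n ≤ 1) : whittakerChar ν n = 0 := by
  have h2 : ¬ n = 2 := by omega
  have h4 : ¬ n = 4 := by omega
  simp [whittakerChar, h2, h4]

theorem shiftWord_word (ν : ℂ) (i : PBWIndex) : shiftWord ν i.word = i.monomial := by
  rw [shiftWord, PBWIndex.monomial_eq]
  congr 1
  refine List.map_congr_left fun n hn => ?_
  rw [shiftL, whittakerChar_of_le_one ν (PBWIndex.le_one_of_mem_word hn), map_zero, sub_zero]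

theorem shiftL_J (c ν : ℂ) {n : ℤ} (hn : 2 ≤ n) : shiftL ν n • J c ν = 0 := by
  rw [J, ← Submodule.Quotient.mk_smul, Submodule.Quotient.mk_eq_zero, smul_eq_mul, mul_one]
  exact Submodule.subset_span (Or.inr ⟨n, hn, rfl⟩)

theorem shiftL_smul {c : ℂ} (ν : ℂ) (n : ℤ) (v : WhittakerModule c ν) :
    shiftL ν n • v = uL n • v - whittakerChar ν n • v := by
  rw [shiftL, sub_smul, algebraMap_smul]

theorem uC_smul {c ν : ℂ} (v : WhittakerModule c ν) : uC • v = c • v := by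
  induction v using Submodule.Quotient.induction_on with
  | _ u =>
    have h : (Submodule.Quotient.mk (uC - algebraMap ℂ U c) : WhittakerModule c ν) = 0 := by
      rw [Submodule.Quotient.mk_eq_zero]
      exact Submodule.subset_span (Or.inl rfl)
    have h1 := congrArg (u • ·) h
    simp only [smul_zero, ← Submodule.Quotient.mk_smul] at h1
    rw [smul_eq_mul, mul_sub, ← uC_mul, ← Algebra.commutes, Submodule.Quotient.mk_sub,
      sub_eq_zero] at h1
    rw [← algebraMap_smul U c, ← Submodule.Quotient.mk_smul, ← Submodule.Quotient.mk_smul,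
      smul_eq_mul, smul_eq_mul, h1]

/-- The scalar term in the commutator of two shifted generators. -/
def shiftCocycle (c ν : ℂ) (m n : ℤ) : ℂ := ((m : ℂ) - n) * whittakerChar ν (m + n) +
  (if m + n = 0 then (m : ℂ) * ((m : ℂ) ^ 2 - 1) / 12 else 0) * c

theorem shiftL_shiftL {c ν : ℂ} (m n : ℤ) (v : WhittakerModule c ν) :
    shiftL ν m • shiftL ν n • v = shiftL ν n • shiftL ν m • v +
      ((m : ℂ) - n) • shiftL ν (m + n) • v + shiftCocycle c ν m n • v := by
  have h := congrArg (· • v) (uL_mul_uL m n)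
  simp only [add_smul, mul_smul, smul_assoc, uC_smul] at h
  simp only [shiftL_smul, smul_sub, smul_comm (uL _) (whittakerChar ν _) v]
  rw [h, shiftCocycle]
  generalize uL m • uL n • v = w₁
  generalize uL n • uL m • v = w₂
  generalize uL m • v = w₃
  generalize uL n • v = w₄
  generalize uL (m + n) • v = w₅
  module

theorem shiftWord_swap {c ν : ℂ} (p q : List ℤ) (x y : ℤ) (v : WhittakerModule c ν) :
    shiftWord ν (p ++ x :: y :: q) • v = shiftWord ν (p ++ y :: x :: q) • v +
      ((x : ℂ) - y) • shiftWord ν (p ++ (x + y) :: q) • v +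
      shiftCocycle c ν x y • shiftWord ν (p ++ q) • v := by
  simp only [shiftWord_append, shiftWord_cons, mul_smul]
  rw [shiftL_shiftL, smul_add, smul_add, smul_comm (shiftWord ν p) ((x : ℂ) - y),
    smul_comm (shiftWord ν p) (shiftCocycle c ν x y)]

/-- A function of words is invariant under permutations modulo `N` if it is invariant under the
exchange of adjacent letters. -/
theorem sub_mem_of_perm {α M : Type*} [AddCommGroup M] (N : AddSubgroup M) (g : List α → M)
    (l₀ : List α) (hswap : ∀ p x y q, (p ++ x :: y :: q).Perm l₀ →
      g (p ++ x :: y :: q) - g (p ++ y :: x :: q) ∈ N) {l l' : List α} (h : l.Perm l') :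
    ∀ p : List α, (p ++ l).Perm l₀ → g (p ++ l) - g (p ++ l') ∈ N := by
  induction h with
  | nil => intro p _; rw [sub_self]; exact N.zero_mem
  | cons x _ ih =>
    intro p hp
    have := ih (p ++ [x]) (by simpa using hp)
    simpa using this
  | swap x y q => intro p hp; exact hswap p y x q hp
  | trans h₁ h₂ ih₁ ih₂ =>
    intro p hp
    have h1 := ih₁ p hp
    have h2 := ih₂ p (((h₁.append_left p).symm).trans hp)
    have := N.add_mem h1 h2
    rwa [sub_add_sub_cancel] at this

/-- The span of the PBW monomials of degree at most `d` and of the parity of `d`. -/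
def degLE (c ν : ℂ) (d : ℤ) : Submodule ℂ (WhittakerModule c ν) :=
  Submodule.span ℂ {v | ∃ i : PBWIndex, (i.deg : ℤ) ≤ d ∧ 2 ∣ d - i.deg ∧ v = i.monomial • J c ν}

theorem letterDeg_add_le (m n : ℤ) : letterDeg (m + n) ≤ letterDeg m + letterDeg n := by
  unfold letterDeg; split_ifs <;> omega

theorem two_dvd_letterDeg_add (m n : ℤ) : 2 ∣ letterDeg m + letterDeg n - letterDeg (m + n) := by
  unfold letterDeg; split_ifs <;> omega

theorem letterDeg_of_shiftCocycle_ne_zero {c ν : ℂ} {m n : ℤ} (h : shiftCocycle c ν m n ≠ 0) :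
    0 ≤ letterDeg m + letterDeg n ∧ 2 ∣ letterDeg m + letterDeg n := by
  have h1 : m + n = 2 ∨ m + n = 4 ∨ m + n = 0 := by
    by_contra! hne
    simp [shiftCocycle, whittakerChar, hne] at h
  unfold letterDeg; split_ifs <;> omega

/-- A word in the shifted generators moves `|J⟩` by at most its degree: straightening a word, the
commutators only produce shorter words, of no larger degree and of the same parity. -/
theorem shiftWord_J_mem_degLE (c ν : ℂ) (l : List ℤ) :
    ∀ d : ℤ, wordDeg l ≤ d → 2 ∣ d - wordDeg l → shiftWord ν l • J c ν ∈ degLE c ν d := by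
  induction hN : l.length using Nat.strong_induction_on generalizing l with
  | _ N ih =>
    intro d hd h2
    have hperm (l' : List ℤ) (h : l.Perm l') :
        shiftWord ν l • J c ν - shiftWord ν l' • J c ν ∈ (degLE c ν d).toAddSubgroup := by
      refine sub_mem_of_perm _ (fun l => shiftWord ν l • J c ν) l ?_ h [] (List.Perm.refl _)
      intro p x y q hp
      have hlen := hp.length_eq
      have hdeg := wordDeg_perm hp
      simp only [List.length_append, List.length_cons, wordDeg_append, wordDeg_cons] at hlen hdeg
      rw [shiftWord_swap, add_assoc, add_sub_cancel_left]
      refine add_mem (?_ : _ ∈ degLE c ν d) (?_ : _ ∈ degLE c ν d)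
      · have h3 := letterDeg_add_le x y
        have h4 := two_dvd_letterDeg_add x y
        refine Submodule.smul_mem _ _ (ih _ ?_ _ rfl d ?_ ?_)
        · simp only [List.length_append, List.length_cons]; omega
        · simp only [wordDeg_append, wordDeg_cons]; omega
        · simp only [wordDeg_append, wordDeg_cons]; omega
      · by_cases hxy : shiftCocycle c ν x y = 0
        · rw [hxy, zero_smul]; exact zero_mem _
        · have h3 := letterDeg_of_shiftCocycle_ne_zero hxy
          refine Submodule.smul_mem _ _ (ih _ ?_ _ rfl d ?_ ?_)
          · simp only [List.length_append]; omega
          · simp only [wordDeg_append]; omega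
          · simp only [wordDeg_append]; omega
    -- A word in the `Lₙ`, `n ≤ 1`, is sorted into a PBW monomial; any other letter is moved to the
    -- right end, where it annihilates `|J⟩`.
    by_cases hl : ∀ n ∈ l, n ≤ 1
    · obtain ⟨i, hi⟩ := PBWIndex.exists_perm_word l hl
      have h1 := hperm _ hi
      have h3 := wordDeg_perm hi
      rw [PBWIndex.wordDeg_word] at h3
      have h4 : shiftWord ν i.word • J c ν ∈ degLE c ν d := by
        rw [shiftWord_word]
        exact Submodule.subset_span ⟨i, by omega, by omega, rfl⟩
      have := Submodule.add_mem _ h1 h4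
      rwa [sub_add_cancel] at this
    · push Not at hl
      obtain ⟨n, hn, hn1⟩ := hl
      have h1 := hperm (l.erase n ++ [n])
        ((List.perm_cons_erase hn).trans (List.perm_append_singleton _ _).symm)
      rwa [shiftWord_append, mul_smul, shiftWord_cons, shiftWord_nil, mul_one,
        shiftL_J c ν (by omega), smul_zero, sub_zero] at h1

theorem shiftWord_mem_degLE {c ν : ℂ} (l : List ℤ) {d : ℤ} {v : WhittakerModule c ν}
    (hv : v ∈ degLE c ν d) : shiftWord ν l • v ∈ degLE c ν (d + wordDeg l) := by
  induction hv using Submodule.span_induction with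
  | mem v hv =>
    obtain ⟨i, h1, h2, rfl⟩ := hv
    rw [← shiftWord_word ν, ← mul_smul, ← shiftWord_append]
    refine shiftWord_J_mem_degLE c ν _ _ ?_ ?_ <;>
      rw [wordDeg_append, PBWIndex.wordDeg_word] <;> omega
  | zero => rw [smul_zero]; exact zero_mem _
  | add x y _ _ hx hy => rw [smul_add]; exact add_mem hx hy
  | smul r x _ hx => rw [smul_comm]; exact Submodule.smul_mem _ _ hx

theorem degLE_eq_bot {c ν : ℂ} {d : ℤ} (hd : d < 0) : degLE c ν d = ⊥ := by
  rw [degLE, Submodule.span_eq_bot]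
  rintro _ ⟨i, h, -, rfl⟩
  omega

/-! ### The PBW basis -/

theorem span_monomial (c ν : ℂ) :
    Submodule.span ℂ (Set.range fun i : PBWIndex => i.monomial • J c ν) = ⊤ := by
  set N := Submodule.span ℂ (Set.range fun i : PBWIndex => i.monomial • J c ν) with hN
  have hdeg (d : ℤ) : degLE c ν d ≤ N :=
    Submodule.span_mono fun _ ⟨i, _, _, h⟩ => ⟨i, h.symm⟩
  have hmon (i : PBWIndex) : i.monomial • J c ν ∈ degLE c ν i.deg :=
    Submodule.subset_span ⟨i, le_rfl, by simp, rfl⟩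
  let S : Subalgebra ℂ U :=
    { carrier := {u | ∀ v ∈ N, u • v ∈ N}
      mul_mem' := fun {a b} ha hb v hv => by rw [mul_smul]; exact ha _ (hb _ hv)
      add_mem' := fun {a b} ha hb v hv => by rw [add_smul]; exact add_mem (ha _ hv) (hb _ hv)
      algebraMap_mem' := fun r v hv => by rw [algebraMap_smul]; exact N.smul_mem _ hv }
  have hS (u : U) : u ∈ S := by
    refine mem_of_generators S (fun n v hv => ?_) (fun v hv => ?_) u
    · induction hv using Submodule.span_induction with
      | mem v hv =>
        obtain ⟨i, rfl⟩ := hv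
        have h1 := hdeg _ (shiftWord_mem_degLE [n] (hmon i))
        rw [shiftWord_cons, shiftWord_nil, mul_one, shiftL_smul] at h1
        have := add_mem h1 (N.smul_mem (whittakerChar ν n) (hdeg _ (hmon i)))
        rwa [sub_add_cancel] at this
      | zero => rw [smul_zero]; exact zero_mem _
      | add x y _ _ hx hy => rw [smul_add]; exact add_mem hx hy
      | smul r x _ hx => rw [smul_comm]; exact Submodule.smul_mem _ _ hx
    · rw [uC_smul]; exact N.smul_mem _ hv
  have hJ : J c ν ∈ N := by
    refine Submodule.subset_span ⟨PBWIndex.vac, ?_⟩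
    simp only
    rw [← shiftWord_word ν, PBWIndex.word_vac, shiftWord_nil, one_smul]
  rw [eq_top_iff]
  intro v _
  induction v using Submodule.Quotient.induction_on with
  | _ u =>
    have := hS u _ hJ
    rwa [J, ← Submodule.Quotient.mk_smul, smul_eq_mul, mul_one] at this

theorem freeField_prod {c ν μ lam s : ℂ} {f : WhittakerModule c ν →ₗ[ℂ] Fock}
    (hf : ∀ (n : ℤ) (v : WhittakerModule c ν), f (uL n • v) = Fock.irrVir μ lam s n (f v))
    (l : List ℤ) (v : WhittakerModule c ν) :
    f ((l.map uL).prod • v) = (l.map (Fock.irrVir μ lam s)).prod (f v) := by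
  induction l with
  | nil => simp
  | cons n l ih => simp [mul_smul, hf, ih]

/-- The free field realization of the Whittaker module is faithful on PBW monomials. -/
theorem linearIndependent_freeField {c ν μ lam s : ℂ} {f : WhittakerModule c ν →ₗ[ℂ] Fock}
    (hs : s ≠ 0) (hJ : f (J c ν) = 1)
    (hf : ∀ (n : ℤ) (v : WhittakerModule c ν), f (uL n • v) = Fock.irrVir μ lam s n (f v)) :
    LinearIndependent ℂ fun i : PBWIndex => f (i.monomial • J c ν) := by
  convert Fock.linearIndependent_irrVir μ lam hs using 2 with i
  rw [PBWIndex.monomial_eq, freeField_prod hf, hJ]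

theorem linearIndependent_monomial (c ν : ℂ) :
    LinearIndependent ℂ fun i : PBWIndex => i.monomial • J c ν := by
  obtain ⟨μ, lam, s, f, hs, hJ, hf⟩ := exists_freeField c ν
  have hs0 : s ≠ 0 := by rintro rfl; norm_num at hs
  exact LinearIndependent.of_comp f (linearIndependent_freeField hs0 hJ hf)

/-- The basis of PBW monomials. -/
def pbwBasis (c ν : ℂ) : Module.Basis PBWIndex ℂ (WhittakerModule c ν) :=
  Module.Basis.mk (linearIndependent_monomial c ν) (span_monomial c ν).ge

theorem pbwBasis_apply (c ν : ℂ) (i : PBWIndex) : pbwBasis c ν i = i.monomial • J c ν :=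
  Module.Basis.mk_apply _ _ i

theorem pbwBasis_vac (c ν : ℂ) : pbwBasis c ν PBWIndex.vac = J c ν := by
  rw [pbwBasis_apply, ← shiftWord_word ν, PBWIndex.word_vac, shiftWord_nil, one_smul]

/-! ### Whittaker functionals -/

/-- The component along `|J⟩` in the basis of PBW monomials. -/
def vacCoord (c ν : ℂ) : WhittakerModule c ν →ₗ[ℂ] ℂ := (pbwBasis c ν).coord PBWIndex.vac

theorem vacCoord_J (c ν : ℂ) : vacCoord c ν (J c ν) = 1 := by
  rw [vacCoord, ← pbwBasis_vac, Module.Basis.coord_apply, Module.Basis.repr_self,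
    Finsupp.single_eq_same]

/-- The component along `|J⟩` has even degree. -/
theorem vacCoord_eq_zero_of_mem_degLE {c ν : ℂ} {d : ℤ} (hd : ¬ 2 ∣ d)
    {v : WhittakerModule c ν} (hv : v ∈ degLE c ν d) : vacCoord c ν v = 0 := by
  have h : degLE c ν d ≤ LinearMap.ker (vacCoord c ν) := by
    refine Submodule.span_le.mpr ?_
    rintro _ ⟨i, -, h2, rfl⟩
    have hi : i ≠ PBWIndex.vac := by
      rintro rfl
      rw [← PBWIndex.wordDeg_word, PBWIndex.word_vac, wordDeg_nil, sub_zero] at h2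
      exact hd h2
    change vacCoord c ν _ = 0
    rw [← pbwBasis_apply, vacCoord, Module.Basis.coord_apply, Module.Basis.repr_self,
      Finsupp.single_eq_of_ne' hi]
  exact h hv

/-- A vector is determined by the components along `|J⟩` of its images under the algebra generated
by the `Lₙ`, `n ≥ 3`. In the free field realization the shifted generators lower the weight, and
only multiples of `|J⟩` are annihilated by all of them. -/
theorem eq_zero_of_vacCoord (c ν : ℂ) (v : WhittakerModule c ν)
    (h : ∀ l : List ℤ, (∀ n ∈ l, 3 ≤ n) → vacCoord c ν (shiftWord ν l • v) = 0) : v = 0 := by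
  obtain ⟨μ, lam, s, f, hs, hJ, hf⟩ := exists_freeField c ν
  have hs0 : s ≠ 0 := by rintro rfl; norm_num at hs
  have hinj : Function.Injective f := by
    rw [← LinearMap.ker_eq_bot, LinearMap.ker_eq_bot']
    intro w hw
    have hli : LinearIndependent ℂ (f ∘ pbwBasis c ν) := by
      simpa only [Function.comp_def, pbwBasis_apply] using linearIndependent_freeField hs0 hJ hf
    have h1 : Finsupp.linearCombination ℂ (f ∘ pbwBasis c ν) ((pbwBasis c ν).repr w) = 0 := by
      rw [← Finsupp.apply_linearCombination, Module.Basis.linearCombination_repr, hw]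
    have h2 := linearIndependent_iff.mp hli _ h1
    exact (LinearEquiv.map_eq_zero_iff _).mp h2
  have hchar {n : ℤ} (hn : 3 ≤ n) :
      whittakerChar ν n = if n = 4 then s ^ 2 / 2 else 0 := by
    have h2 : ¬ n = 2 := by omega
    rw [whittakerChar, if_neg h2, hs]
    norm_num
  have hshift {n : ℤ} (hn : 3 ≤ n) (w : WhittakerModule c ν) : f (shiftL ν n • w) =
      Fock.irrVir μ lam s n (f w) - (if n = 4 then s ^ 2 / 2 else 0 : ℂ) • f w := by
    rw [shiftL_smul, map_sub, hf, map_smul, hchar hn]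
  obtain ⟨k, hd⟩ : ∃ k : ℕ, f v ∈ Fock.wtLE ((k : ℤ) - 1) := by
    obtain ⟨d, hd⟩ := Fock.exists_mem_wtLE (f v)
    exact ⟨d + 1, by simpa using hd⟩
  induction k generalizing v with
  | zero =>
    apply hinj
    rw [map_zero]
    exact Fock.eq_zero_of_mem_wtLE_neg (by simp) hd
  | succ k ih =>
    have hann (n : ℤ) (hn : 3 ≤ n) : shiftL ν n • v = 0 := by
      refine ih _ (fun l hl => ?_) ?_
      · have := h (l ++ [n]) (by
          intro m hm
          rcases List.mem_append.mp hm with hm | hm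
          · exact hl m hm
          · rw [List.mem_singleton.mp hm]; exact hn)
        rwa [shiftWord_append, shiftWord_cons, shiftWord_nil, mul_one, mul_smul] at this
      · rw [hshift hn]
        have := Fock.irrVir_sub_mem_wtLE μ lam s hn hd
        push_cast at this
        simpa using this
    have hconst := Fock.eq_C_of_irrVir μ lam hs0 (f v) fun n hn => by
      rw [← sub_eq_zero, ← hshift hn, hann n hn, map_zero]
    rw [← hJ, ← map_smul] at hconst
    have hv := hinj hconst
    have h0 := h [] (by simp)
    rw [shiftWord_nil, one_smul, hv, map_smul, vacCoord_J, smul_eq_mul, mul_one] at h0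
    rw [hv, h0, zero_smul]

/-- The coefficient of `εᵏ` in the character `L₅ ↦ ε`, `Lₙ - whittakerChar ν n ↦ 0` (`n ≠ 5`) of the
algebra generated by the `Lₙ`, `n ≥ 3`. -/
def charCoeff (k : ℕ) (l : List ℤ) : ℂ := if l = List.replicate k 5 then 1 else 0

theorem charCoeff_nil (k : ℕ) : charCoeff k [] = if k = 0 then 1 else 0 := by
  cases k <;> simp [charCoeff, List.replicate_succ]

theorem charCoeff_of_mem {k : ℕ} {l : List ℤ} {n : ℤ} (hn : n ∈ l) (h5 : n ≠ 5) :
    charCoeff k l = 0 := by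
  rw [charCoeff, if_neg]
  rintro rfl
  exact h5 (List.eq_of_mem_replicate hn)

theorem charCoeff_zero_append_five (l : List ℤ) : charCoeff 0 (l ++ [5]) = 0 := by
  simp [charCoeff]

theorem charCoeff_succ_append_five (k : ℕ) (l : List ℤ) :
    charCoeff (k + 1) (l ++ [5]) = charCoeff k l := by
  simp [charCoeff, List.replicate_succ']

theorem charCoeff_perm {k : ℕ} {l l' : List ℤ} (h : l.Perm l') :
    charCoeff k l = charCoeff k l' := by
  have : l = List.replicate k 5 ↔ l' = List.replicate k 5 :=
    ⟨fun e => List.perm_replicate.mp (e ▸ h.symm), fun e => List.perm_replicate.mp (e ▸ h)⟩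
  simp only [charCoeff, this]

/-- A sorted word in the `Lₙ`, `n ≥ 3`: the dual of a PBW monomial, in which `Lₙ` corresponds to
`L₄₋ₙ`. -/
def dualWord (i : PBWIndex) : List ℤ := i.word.map (4 - ·)

theorem exists_perm_dualWord (l : List ℤ) (hl : ∀ n ∈ l, 3 ≤ n) :
    ∃ i : PBWIndex, l.Perm (dualWord i) := by
  obtain ⟨i, hi⟩ := PBWIndex.exists_perm_word (l.map (4 - ·)) (by
    intro n hn
    obtain ⟨m, hm, rfl⟩ := List.mem_map.mp hn
    have := hl m hm
    omega)
  refine ⟨i, ?_⟩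
  have := hi.map (4 - ·)
  rw [List.map_map] at this
  simpa [Function.comp_def, dualWord] using this

theorem wordDeg_dualWord (i : PBWIndex) : wordDeg (dualWord i) = -i.deg := by
  rw [dualWord, wordDeg_map_reflect _ fun _ => PBWIndex.le_one_of_mem_word, PBWIndex.wordDeg_word]

theorem shiftCocycle_of_three_le (c ν : ℂ) {m n : ℤ} (hm : 3 ≤ m) (hn : 3 ≤ n) :
    shiftCocycle c ν m n = 0 := by
  have h1 : ¬ m + n = 0 := by omega
  have h2 : ¬ m + n = 2 := by omega
  have h4 : ¬ m + n = 4 := by omega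
  simp [shiftCocycle, whittakerChar, h1, h2, h4]

/-- The functionals `u ↦ ⟨u v⟩` and `u ↦ [εᵏ] χ(u)` agree as soon as they agree on sorted words,
because `χ` is a character: it vanishes on all commutators. -/
theorem vacCoord_shiftWord_eq {c ν : ℂ} {k : ℕ} {v : WhittakerModule c ν} {r : ℂ}
    (h : ∀ i, vacCoord c ν (shiftWord ν (dualWord i) • v) = r * charCoeff k (dualWord i))
    (l : List ℤ) (hl : ∀ n ∈ l, 3 ≤ n) :
    vacCoord c ν (shiftWord ν l • v) = r * charCoeff k l := by
  induction hN : l.length using Nat.strong_induction_on generalizing l with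
  | _ N ih =>
    obtain ⟨i, hi⟩ := exists_perm_dualWord l hl
    have h1 := sub_mem_of_perm ⊥ (fun l => vacCoord c ν (shiftWord ν l • v) - r * charCoeff k l) l
      ?_ hi [] (List.Perm.refl _)
    · simp only [List.nil_append, AddSubgroup.mem_bot, h i, sub_self, sub_zero] at h1
      exact sub_eq_zero.mp h1
    · intro p x y q hp
      have hlen := hp.length_eq
      simp only [List.length_append, List.length_cons] at hlen
      have hmem (n : ℤ) (hn : n ∈ p ++ x :: y :: q) : 3 ≤ n := hl n (hp.mem_iff.mp hn)
      have hx := hmem x (by simp)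
      have hy := hmem y (by simp)
      have h2 : vacCoord c ν (shiftWord ν (p ++ (x + y) :: q) • v) = 0 := by
        rw [ih (p ++ (x + y) :: q).length (by simp; omega) (p ++ (x + y) :: q) ?_ rfl,
          charCoeff_of_mem (n := x + y) (by simp) (by omega), mul_zero]
        · intro n hn
          simp only [List.mem_append, List.mem_cons] at hn
          rcases hn with hn | rfl | hn
          · exact hmem n (by simp [hn])
          · omega
          · exact hmem n (by simp [hn])
      rw [AddSubgroup.mem_bot, shiftWord_swap, shiftCocycle_of_three_le c ν hx hy, zero_smul,
        add_zero, map_add, (vacCoord c ν).map_smul, h2, smul_zero, add_zero,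
        charCoeff_perm ((List.Perm.swap y x q).append_left p), sub_self]

theorem eq_zero_of_vacCoord_dualWord (c ν : ℂ) (v : WhittakerModule c ν)
    (h : ∀ i, vacCoord c ν (shiftWord ν (dualWord i) • v) = 0) : v = 0 :=
  eq_zero_of_vacCoord c ν v fun l hl => by
    simpa using vacCoord_shiftWord_eq (k := 0) (r := 0) (by simpa using h) l hl

/-! ### The rank 5/2 state -/

/-- The terms of the rank `5/2` state. The pairing of the PBW monomials of degree at most `k` and
of the parity of `k` with their dual words is an injective, hence bijective, map between
finite-dimensional spaces. -/
theorem exists_whittakerTerm (c ν : ℂ) (k : ℕ) : ∃ v ∈ degLE c ν k,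
    ∀ l : List ℤ, (∀ n ∈ l, 3 ≤ n) → vacCoord c ν (shiftWord ν l • v) = charCoeff k l := by
  let I := {i : PBWIndex // i.deg ≤ k ∧ 2 ∣ (k : ℤ) - i.deg}
  have : Finite I := ((PBWIndex.finite_deg_le k).subset fun i hi => hi.1).to_subtype
  have : Fintype I := Fintype.ofFinite I
  let g : (I → ℂ) →ₗ[ℂ] WhittakerModule c ν := Fintype.linearCombination ℂ fun i : I =>
    pbwBasis c ν i
  have hg (x : I → ℂ) : g x ∈ degLE c ν k := by
    rw [Fintype.linearCombination_apply]
    refine Submodule.sum_mem _ fun i _ => Submodule.smul_mem _ _ (Submodule.subset_span ?_)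
    exact ⟨i, by exact_mod_cast i.2.1, i.2.2, pbwBasis_apply c ν i⟩
  have hginj : Function.Injective g := by
    have := (pbwBasis c ν).linearIndependent.comp (Subtype.val : I → PBWIndex)
      Subtype.val_injective
    exact this.fintypeLinearCombination_injective
  have hout {v : WhittakerModule c ν} (hv : v ∈ degLE c ν k) (i : PBWIndex)
      (hi : ¬ (i.deg ≤ k ∧ 2 ∣ (k : ℤ) - i.deg)) :
      vacCoord c ν (shiftWord ν (dualWord i) • v) = 0 := by
    have h1 := shiftWord_mem_degLE (dualWord i) hv
    rw [wordDeg_dualWord, ← sub_eq_add_neg] at h1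
    by_cases h2 : 2 ∣ (k : ℤ) - i.deg
    · rw [degLE_eq_bot (by omega), Submodule.mem_bot] at h1
      rw [h1, map_zero]
    · exact vacCoord_eq_zero_of_mem_degLE h2 h1
  let P : (I → ℂ) →ₗ[ℂ] (I → ℂ) := LinearMap.pi fun i : I =>
    vacCoord c ν ∘ₗ Algebra.lsmul ℂ ℂ (WhittakerModule c ν) (shiftWord ν (dualWord i)) ∘ₗ g
  have hP (x : I → ℂ) (i : I) : P x i = vacCoord c ν (shiftWord ν (dualWord i) • g x) := rfl
  have hPinj : Function.Injective P := by
    rw [← LinearMap.ker_eq_bot, LinearMap.ker_eq_bot']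
    intro x hx
    refine hginj ((eq_zero_of_vacCoord_dualWord c ν (g x) fun i => ?_).trans (map_zero g).symm)
    by_cases hi : i.deg ≤ k ∧ 2 ∣ (k : ℤ) - i.deg
    · rw [← hP x ⟨i, hi⟩, hx, Pi.zero_apply]
    · exact hout (hg x) i hi
  obtain ⟨x, hx⟩ := LinearMap.injective_iff_surjective.mp hPinj fun i => charCoeff k (dualWord i)
  refine ⟨g x, hg x, fun l hl => ?_⟩
  rw [vacCoord_shiftWord_eq (k := k) (r := 1) (fun i => ?_) l hl, one_mul]
  rw [one_mul]
  by_cases hi : i.deg ≤ k ∧ 2 ∣ (k : ℤ) - i.deg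
  · rw [← hP x ⟨i, hi⟩, hx]
  · rw [hout (hg x) i hi, charCoeff, if_neg]
    intro he
    -- the word `5, …, 5` of length `k` has degree `-k`
    have h1 := wordDeg_dualWord i
    rw [he] at h1
    have h2 : wordDeg (List.replicate k 5) = -k := by simp [wordDeg, letterDeg]
    apply hi
    omega

theorem repr_ne_zero_of_mem_degLE {c ν : ℂ} {d : ℤ} {v : WhittakerModule c ν}
    (hv : v ∈ degLE c ν d) {i : PBWIndex} (hi : (pbwBasis c ν).repr v i ≠ 0) :
    (i.deg : ℤ) ≤ d ∧ 2 ∣ d - i.deg := by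
  by_contra hne
  have h : degLE c ν d ≤ LinearMap.ker ((pbwBasis c ν).coord i) := by
    refine Submodule.span_le.mpr ?_
    rintro _ ⟨j, h1, h2, rfl⟩
    have hj : j ≠ i := by rintro rfl; exact hne ⟨h1, h2⟩
    change (pbwBasis c ν).coord i _ = 0
    rw [← pbwBasis_apply, Module.Basis.coord_apply, Module.Basis.repr_self,
      Finsupp.single_eq_of_ne' hj]
  exact hi (h hv)

/-- The relations of a rank `5/2` Whittaker state in terms of the shifted generators. -/
theorem IsWhittaker52.shiftL_smul_eq {c ν : ℂ} {Ψ : WhittakerSeries c ν} (h : IsWhittaker52 Ψ)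
    {n : ℤ} (hn : 3 ≤ n) (k : ℕ) :
    shiftL ν n • Ψ k = if n = 5 then epsMul Ψ k else 0 := by
  have h2 : ¬ n = 2 := by omega
  rw [shiftL_smul, whittakerChar, if_neg h2]
  rcases (by omega : n = 3 ∨ n = 4 ∨ n = 5 ∨ 6 ≤ n) with rfl | rfl | rfl | h6
  · have := congrFun h.L_three k
    simpa using this
  · have := congrFun h.L_four k
    simpa [sub_eq_zero] using this
  · have := congrFun h.L_five k
    simpa using this
  · have := congrFun (h.L_ge_six n h6) k
    have h4 : ¬ n = 4 := by omega
    have h5 : ¬ n = 5 := by omega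
    simpa [h4, h5] using this

theorem isWhittaker52_of_shiftL {c ν : ℂ} {Ψ : WhittakerSeries c ν}
    (h : ∀ n : ℤ, 3 ≤ n → ∀ k, shiftL ν n • Ψ k = if n = 5 then epsMul Ψ k else 0) :
    IsWhittaker52 Ψ where
  L_ge_six n hn := by
    funext k
    have := h n (by omega) k
    have h2 : ¬ n = 2 := by omega
    have h4 : ¬ n = 4 := by omega
    have h5 : ¬ n = 5 := by omega
    simpa [shiftL_smul, whittakerChar, h2, h4, h5] using this
  L_five := by
    funext k
    simpa [shiftL_smul, whittakerChar] using h 5 (by norm_num) k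
  L_four := by
    funext k
    simpa [shiftL_smul, whittakerChar, sub_eq_zero] using h 4 (by norm_num) k
  L_three := by
    funext k
    simpa [shiftL_smul, whittakerChar] using h 3 (by norm_num) k

/-- Two rank `5/2` Whittaker states with the same components along `|J⟩` are equal. -/
theorem IsWhittaker52.ext_vacCoord {c ν : ℂ} {Ψ Ψ' : WhittakerSeries c ν}
    (h : IsWhittaker52 Ψ) (h' : IsWhittaker52 Ψ')
    (hvac : ∀ k, vacCoord c ν (Ψ k) = vacCoord c ν (Ψ' k)) : Ψ = Ψ' := by
  have step (k : ℕ) (hk : epsMul Ψ k = epsMul Ψ' k) : Ψ k = Ψ' k := by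
    rw [← sub_eq_zero]
    refine eq_zero_of_vacCoord c ν _ fun l hl => ?_
    rcases l.eq_nil_or_concat' with rfl | ⟨l, n, rfl⟩
    · rw [shiftWord_nil, one_smul, map_sub, hvac, sub_self]
    · have hn : 3 ≤ n := hl n (by simp)
      rw [shiftWord_append, mul_smul, shiftWord_cons, shiftWord_nil, mul_one, smul_sub (shiftL ν n),
        h.shiftL_smul_eq hn, h'.shiftL_smul_eq hn, hk, sub_self, smul_zero, map_zero]
  funext k
  induction k with
  | zero => exact step 0 rfl
  | succ k ih => exact step (k + 1) ih

/-- The terms found by inverting the pairing form a rank `5/2` Whittaker state. -/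
theorem exists_whittakerState (c ν : ℂ) : ∃ Ψ : WhittakerSeries c ν, IsWhittaker52 Ψ ∧
    Ψ 0 = J c ν ∧ ∀ k : ℕ, Ψ k ∈ degLE c ν k ∧ vacCoord c ν (Ψ k) = if k = 0 then 1 else 0 := by
  choose Ψ hdeg hΨ using exists_whittakerTerm c ν
  have hvac (k : ℕ) : vacCoord c ν (Ψ k) = if k = 0 then 1 else 0 := by
    rw [← charCoeff_nil, ← hΨ k [] (by simp), shiftWord_nil, one_smul]
  have hΨ' (k : ℕ) (l : List ℤ) (n : ℤ) (hl : ∀ m ∈ l, 3 ≤ m) (hn : 3 ≤ n) :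
      vacCoord c ν (shiftWord ν l • shiftL ν n • Ψ k) = charCoeff k (l ++ [n]) := by
    rw [← hΨ k (l ++ [n]), shiftWord_append, mul_smul, shiftWord_cons, shiftWord_nil, mul_one]
    intro m hm
    rcases List.mem_append.mp hm with hm | hm
    · exact hl m hm
    · rw [List.mem_singleton.mp hm]; exact hn
  refine ⟨Ψ, isWhittaker52_of_shiftL fun n hn k => ?_, ?_, fun k => ⟨hdeg k, hvac k⟩⟩
  · rw [← sub_eq_zero]
    refine eq_zero_of_vacCoord c ν _ fun l hl => ?_
    rw [smul_sub, map_sub, hΨ' k l n hl hn]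
    split_ifs with h5
    · subst h5
      rcases k with _ | k
      · rw [charCoeff_zero_append_five]; simp [epsMul]
      · rw [charCoeff_succ_append_five, epsMul, hΨ k l hl, sub_self]
    · rw [charCoeff_of_mem (n := n) (by simp) h5, smul_zero, map_zero, sub_zero]
  · rw [← sub_eq_zero]
    refine eq_zero_of_vacCoord c ν _ fun l hl => ?_
    rcases l.eq_nil_or_concat' with rfl | ⟨l, n, rfl⟩
    · rw [shiftWord_nil, one_smul, map_sub, hvac, vacCoord_J, if_pos rfl, sub_self]
    · have hn : 3 ≤ n := hl n (by simp)
      rw [smul_sub, map_sub, hΨ 0 _ hl, shiftWord_append, mul_smul, shiftWord_cons, shiftWord_nil,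
        mul_one, shiftL_J c ν (by omega), smul_zero, map_zero, sub_zero, charCoeff,
        List.replicate_zero, if_neg (by simp)]

end Virasoro

end

theorem theorem3p2 (c ν : ℂ) :
    ∃ b : Module.Basis Virasoro.PBWIndex ℂ (Virasoro.WhittakerModule c ν),
      (∀ i, b i = i.monomial • Virasoro.J c ν) ∧
      ∃ Ψ : Virasoro.WhittakerSeries c ν,
        Virasoro.IsOrthogonalWhittaker52 b Ψ ∧
        (∀ Ψ' : Virasoro.WhittakerSeries c ν,
          Virasoro.IsOrthogonalWhittaker52 b Ψ' → Ψ' = Ψ) ∧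
        ∀ k : ℕ, 1 ≤ k → ∀ i : Virasoro.PBWIndex, b.repr (Ψ k) i ≠ 0 →
          1 ≤ i.deg ∧ i.deg ≤ k ∧ i.deg ≡ k [MOD 2] := by
  obtain ⟨Ψ, hW, hJ, hΨ⟩ := Virasoro.exists_whittakerState c ν
  have hgauge (k : ℕ) (hk : 1 ≤ k) :
      (Virasoro.pbwBasis c ν).repr (Ψ k) Virasoro.PBWIndex.vac = 0 :=
    (hΨ k).2.trans (if_neg (by omega))
  refine ⟨Virasoro.pbwBasis c ν, Virasoro.pbwBasis_apply c ν, Ψ, ⟨hW, hJ, hgauge⟩,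
    fun Ψ' h' => h'.whittaker.ext_vacCoord hW fun k => ?_, fun k hk i hi => ?_⟩
  · rcases Nat.eq_zero_or_pos k with rfl | hk
    · rw [h'.coeff_zero, hJ]
    · exact (h'.gauge k hk).trans (hgauge k hk).symm
  · obtain ⟨h1, h2⟩ := Virasoro.repr_ne_zero_of_mem_degLE (hΨ k).1 hi
    refine ⟨?_, by exact_mod_cast h1, (Nat.modEq_iff_dvd).mpr h2⟩
    by_contra h0
    rw [Virasoro.PBWIndex.eq_vac_of_deg_eq_zero (i := i) (by omega)] at hi
    exact hi (hgauge k hk)
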